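/- All topological groups are Hausdorff; a TDLC group is a totally disconnected locally compact group. All graphs are simplicial, and a connected graph carries the path metric with edges of length one. Let $G$ be a TDLC group and $\mathcal H$ a finite collection of open subgroups of $G$. - $G$ is compactly generated relative to $\mathcal H$ if there is a compact set $K\subseteq G$ such that $K\cup\bigcup_{H\in\mathcal H}H$ generates $G$. - $(G,\mathcal H)$ is a proper pair if no two distinct non-compact members of $\mathcal H$ are conjugate in $G$. - A Cayley–Abels graph of a proper pair $(G,\mathcal H)$ is a connected graph $X$ with an action of $G$ by automorphisms, with finitely many orbits of vertices and edges and open vertex stabilizers, such that edge stabilizers are compact; every vertex stabilizer is compact or conjugate to a member of $\mathcal H$; every $H\in\mathcal H$ is the stabilizer of a vertex; and any two vertices with the same non-compact stabilizer $H\in\mathcal H$ lie in the same $G$-orbit. - A graph is fine if for all vertices $u,v$ and all $n\in\mathbb N$ there are only finitely many embedded paths of length $n$ from $u$ to $v$. - $G$ is hyperbolic relative to $\mathcal H$ if $(G,\mathcal H)$ is a proper pair that has a fine and Gromov hyperbolic Cayley–Abels graph. **Theorem 1.2.** Let $A$ be a TDLC group that is compactly generated relative to a finite collection $\mathcal H$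 of open subgroups and hyperbolic relative to $\mathcal H$. Let $C\le A$ be an open subgroup, let $\alpha$ be a topological isomorphism from $C$ onto an open subgroup of $A$, and let $G=A*_C=\langle A,t\mid t^{-1}ct=\alpha(c)\ (c\in C)\rangle$ be the HNN extension, with the unique group topology for which the inclusion $A\to G$ is an open topological embedding. If $C$ is compact, then $G$ is hyperbolic relative to $\mathcal H$ (its members being viewed as subgroups of $G$ via $A\to G$); in particular $G$ is a TDLC group and $(G,\mathcal H)$ is a proper pair. -/

import Mathlib

open Filter Topology

universe u

/-! ### The canonical topology on an HNN extension -/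

namespace HNNExtension

variable {A : Type u} [Group A] [TopologicalSpace A] {C D : Subgroup A}

/-- The topology on the HNN extension `A *_φ` of a topological group `A`: a set `S` is open iff
for every `g` the set of all `a : A` with `g * a ∈ S` is open in `A`. If `A` is a topological
group and `φ : C ≃ D` is a topological isomorphism of open subgroups, this is the unique group
topology for which the inclusion of `A` is an open embedding; see `isTopologicalGroup`,
`isOpenEmbedding_of` and `eq_of_isOpenEmbedding_of` below. -/
instance instTopologicalSpace {φ : C ≃* D} : TopologicalSpace (HNNExtension A C D φ) :=
  ⨆ g : HNNExtension A C D φ,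
    TopologicalSpace.coinduced (fun a : A => g * of a) inferInstance

theorem isOpen_iff' {φ : C ≃* D} {S : Set (HNNExtension A C D φ)} :
    IsOpen S ↔ ∀ g, IsOpen ((fun a : A => g * of a) ⁻¹' S) := by
  unfold instTopologicalSpace
  simp only [isOpen_iSup_iff, isOpen_coinduced]

theorem isOpenEmbedding_of [IsTopologicalGroup A] {φ : C ≃* D} :
    IsOpenEmbedding (of : A → HNNExtension A C D φ) := by
  refine IsOpenEmbedding.of_continuous_injective_isOpenMap ?_ (of_injective φ) ?_
  · refine continuous_def.2 fun S hS => ?_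
    simpa using isOpen_iff'.1 hS 1
  · intro U hU
    refine isOpen_iff'.2 fun g => ?_
    by_cases hg : ∃ b : A, of b = g
    · obtain ⟨b, rfl⟩ := hg
      have : (fun a : A => (of b : HNNExtension A C D φ) * of a) ⁻¹' (of '' U)
          = (fun a => b * a) ⁻¹' U := by
        ext a
        simp only [Set.mem_preimage, ← map_mul]
        exact (of_injective φ).mem_set_image
      rw [this]
      exact hU.preimage (continuous_const_mul b)
    · convert isOpen_empty
      ext a
      simp only [Set.mem_preimage, Set.mem_image, Set.mem_empty_iff_false, iff_false]
      rintro ⟨x, -, hx⟩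
      exact hg ⟨x * a⁻¹, by rw [map_mul, hx, map_inv, mul_inv_cancel_right]⟩

theorem nhds_one_eq_map [IsTopologicalGroup A] {φ : C ≃* D} :
    𝓝 (1 : HNNExtension A C D φ) = map of (𝓝 (1 : A)) := by
  rw [isOpenEmbedding_of.map_nhds_eq, map_one]

theorem isTopologicalGroup [IsTopologicalGroup A] (φ : C ≃ₜ* D)
    (hC : IsOpen (C : Set A)) (hD : IsOpen (D : Set A)) :
    IsTopologicalGroup (HNNExtension A C D (φ : C ≃* D)) := by
  have hleft : ∀ g : HNNExtension A C D (φ : C ≃* D), Continuous (fun x => g * x) := by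
    intro g
    refine continuous_def.2 fun S hS => isOpen_iff'.2 fun g' => ?_
    have := isOpen_iff'.1 hS (g * g')
    simpa [Set.preimage, mul_assoc] using this
  have hC1 : 𝓝 (1 : A) = map ((↑) : C → A) (𝓝 1) :=
    (hC.isOpenEmbedding_subtypeVal.map_nhds_eq (1 : C)).symm
  have hD1 : 𝓝 (1 : A) = map ((↑) : D → A) (𝓝 1) :=
    (hD.isOpenEmbedding_subtypeVal.map_nhds_eq (1 : D)).symm
  have hcof : ContinuousAt (of : A → HNNExtension A C D (φ : C ≃* D)) 1 :=
    isOpenEmbedding_of.continuous.continuousAt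
  have hof : Tendsto (of : A → HNNExtension A C D (φ : C ≃* D)) (𝓝 1) (𝓝 1) := by
    simpa using hcof.tendsto
  have key : ∀ x₀ : HNNExtension A C D (φ : C ≃* D),
      Tendsto (fun x => x₀ * x * x₀⁻¹) (𝓝 1) (𝓝 1) ∧
      Tendsto (fun x => x₀⁻¹ * x * x₀) (𝓝 1) (𝓝 1) := by
    intro x₀
    induction x₀ using HNNExtension.induction_on with
    | of a =>
      constructor
      · have h : Tendsto (fun b : A => a * b * a⁻¹) (𝓝 1) (𝓝 1) := by
          have : Continuous (fun b : A => a * b * a⁻¹) := by fun_prop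
          simpa using this.tendsto 1
        nth_rewrite 1 [nhds_one_eq_map]
        rw [tendsto_map'_iff]
        refine (hof.comp h).congr fun b => ?_
        simp
      · have h : Tendsto (fun b : A => a⁻¹ * b * a) (𝓝 1) (𝓝 1) := by
          have : Continuous (fun b : A => a⁻¹ * b * a) := by fun_prop
          simpa using this.tendsto 1
        nth_rewrite 1 [nhds_one_eq_map]
        rw [tendsto_map'_iff]
        refine (hof.comp h).congr fun b => ?_
        simp
    | t =>
      constructor
      · nth_rewrite 1 [nhds_one_eq_map]
        rw [tendsto_map'_iff, hC1, tendsto_map'_iff]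
        have h : Tendsto (fun c : C => (φ c : A)) (𝓝 1) (𝓝 1) := by
          have : Continuous (fun c : C => (φ c : A)) :=
            continuous_subtype_val.comp φ.continuous
          simpa using this.tendsto 1
        refine (hof.comp h).congr fun c => ?_
        exact equiv_eq_conj (φ := (φ : C ≃* D)) c
      · nth_rewrite 1 [nhds_one_eq_map]
        rw [tendsto_map'_iff, hD1, tendsto_map'_iff]
        have h : Tendsto (fun d : D => (φ.symm d : A)) (𝓝 1) (𝓝 1) := by
          have : Continuous (fun d : D => (φ.symm d : A)) :=
            continuous_subtype_val.comp φ.symm.continuous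
          simpa using this.tendsto 1
        refine (hof.comp h).congr fun d => ?_
        exact equiv_symm_eq_conj (φ := (φ : C ≃* D)) d
    | mul x y hx hy =>
      refine ⟨(hx.1.comp hy.1).congr fun z => ?_, (hy.2.comp hx.2).congr fun z => ?_⟩ <;>
        simp [mul_assoc]
    | inv x hx => simpa using hx.symm
  refine IsTopologicalGroup.of_nhds_one ?_ ?_ ?_ fun x₀ => (key x₀).1
  · nth_rewrite 1 [nhds_one_eq_map]
    nth_rewrite 1 [nhds_one_eq_map]
    rw [prod_map_map_eq, tendsto_map'_iff]
    have h : Tendsto (fun p : A × A => p.1 * p.2) (𝓝 1 ×ˢ 𝓝 1) (𝓝 1) := by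
      rw [← nhds_prod_eq]
      simpa using (continuous_mul (M := A)).tendsto (1, 1)
    refine (hof.comp h).congr fun p => ?_
    simp [Function.uncurry]
  · nth_rewrite 1 [nhds_one_eq_map]
    rw [tendsto_map'_iff]
    have h : Tendsto (fun a : A => a⁻¹) (𝓝 1) (𝓝 1) := by
      simpa using (continuous_inv (G := A)).tendsto 1
    refine (hof.comp h).congr fun p => ?_
    simp
  · intro x₀
    let e : HNNExtension A C D (φ : C ≃* D) ≃ₜ HNNExtension A C D (φ : C ≃* D) :=
      { Equiv.mulLeft x₀ with
        continuous_toFun := hleft x₀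
        continuous_invFun := hleft x₀⁻¹ }
    have := e.map_nhds_eq 1
    rw [show e 1 = x₀ from mul_one x₀] at this
    exact this.symm

/-- Uniqueness of the topology: any group topology for which the inclusion of `A` is an open
embedding is the one above. -/
theorem eq_of_isOpenEmbedding_of [IsTopologicalGroup A] (φ : C ≃ₜ* D)
    (hC : IsOpen (C : Set A)) (hD : IsOpen (D : Set A))
    (τ : TopologicalSpace (HNNExtension A C D (φ : C ≃* D)))
    (hτ : @IsTopologicalGroup _ τ _)
    (hof : @IsOpenEmbedding A (HNNExtension A C D (φ : C ≃* D)) _ τ of) :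
    τ = instTopologicalSpace := by
  refine IsTopologicalGroup.ext hτ (isTopologicalGroup φ hC hD) ?_
  have h := @IsOpenEmbedding.map_nhds_eq A (HNNExtension A C D (φ : C ≃* D)) of _ τ hof 1
  rw [map_one] at h
  rw [← h, nhds_one_eq_map]

end HNNExtension

/-! ### TDLC groups and proper pairs -/

/-- `G` is a TDLC group: a Hausdorff, locally compact, totally disconnected topological group. -/
structure IsTDLCGroup (G : Type u) [Group G] [TopologicalSpace G] : Prop where
  isTopologicalGroup : IsTopologicalGroup G
  t2Space : T2Space G
  locallyCompactSpace : LocallyCompactSpace G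
  totallyDisconnectedSpace : TotallyDisconnectedSpace G

/-- The conjugate subgroup `g H g⁻¹`. -/
def conjSubgroup {G : Type u} [Group G] (g : G) (H : Subgroup G) : Subgroup G :=
  H.map (MulAut.conj g).toMonoidHom

/-- `(G, ℋ)` is a proper pair: `G` is a TDLC group, `ℋ` is a finite collection of open subgroups
of `G`, and no two distinct non-compact members of `ℋ` are conjugate in `G`. -/
structure IsProperPair (G : Type u) [Group G] [TopologicalSpace G]
    (ℋ : Set (Subgroup G)) : Prop where
  isTDLCGroup : IsTDLCGroup G
  finite : ℋ.Finite
  isOpen : ∀ H ∈ ℋ, IsOpen (H : Set G)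
  not_conj : ∀ H ∈ ℋ, ∀ K ∈ ℋ, H ≠ K → ¬ IsCompact (H : Set G) → ¬ IsCompact (K : Set G) →
    ∀ g : G, conjSubgroup g H ≠ K

/-- `G` is compactly generated relative to `ℋ`: some compact set together with the members of `ℋ`
generates `G` algebraically. -/
def IsCompactlyGeneratedRel (G : Type u) [Group G] [TopologicalSpace G]
    (ℋ : Set (Subgroup G)) : Prop :=
  ∃ K : Set G, IsCompact K ∧ Subgroup.closure (K ∪ ⋃ H ∈ ℋ, (H : Set G)) = ⊤

/-! ### Fine graphs, hyperbolic graphs, relative Cayley-Abels graphs -/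

/-- A graph is fine if for all vertices `u`, `v` and all `n` there are only finitely many embedded
paths of length `n` from `u` to `v`. -/
def IsFineGraph {V : Type u} (X : SimpleGraph V) : Prop :=
  ∀ (u v : V) (n : ℕ), {p : X.Walk u v | p.IsPath ∧ p.length = n}.Finite

/-- Gromov hyperbolicity of a (connected) graph with edges of length one, by Gromov's four point
condition for the path metric on the vertices. The vertex set is `1/2`-dense in the geodesic metric
space underlying the graph, so up to a change of `δ` this is the four point condition (equivalently
the slimness of geodesic triangles) for that space. -/
def IsHyperbolicGraph {V : Type u} (X : SimpleGraph V) : Prop :=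
  ∃ δ : ℕ, ∀ x y z w : V,
    X.dist x y + X.dist z w ≤
      max (X.dist x z + X.dist y w) (X.dist x w + X.dist y z) + δ

/-- The graph `X`, with an action of `G` on its vertices, is a Cayley-Abels graph of `G` with
respect to `ℋ`. -/
structure IsRelCayleyAbelsGraph {G : Type u} [Group G] [TopologicalSpace G]
    (ℋ : Set (Subgroup G)) {V : Type u} [MulAction G V] (X : SimpleGraph V) : Prop where
  /-- `X` is connected (in particular non-empty). -/
  connected : X.Connected
  /-- `G` acts by graph automorphisms. -/
  smul_adj : ∀ (g : G) (u v : V), X.Adj u v → X.Adj (g • u) (g • v)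
  /-- The action is cocompact: there are finitely many orbits of vertices ... -/
  finite_vertex_orbits : ∃ F : Set V, F.Finite ∧ ∀ v : V, ∃ g : G, ∃ w ∈ F, v = g • w
  /-- ... and finitely many orbits of edges. -/
  finite_edge_orbits : ∃ F : Set (Sym2 V), F.Finite ∧
    ∀ e ∈ X.edgeSet, ∃ g : G, ∃ f ∈ F, e = f.map (g • ·)
  /-- The action is discrete: pointwise stabilizers of vertices are open (hence also those of
  edges, being intersections of two vertex stabilizers). -/
  isOpen_stabilizer : ∀ v : V, IsOpen (MulAction.stabilizer G v : Set G)
  /-- Stabilizers of edges are compact. -/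
  isCompact_edge_stabilizer : ∀ e ∈ X.edgeSet, IsCompact {g : G | e.map (g • ·) = e}
  /-- Stabilizers of vertices are compact or conjugate to members of `ℋ`. -/
  vertex_stabilizer : ∀ v : V, IsCompact (MulAction.stabilizer G v : Set G) ∨
    ∃ H ∈ ℋ, ∃ g : G, MulAction.stabilizer G v = conjSubgroup g H
  /-- Every member of `ℋ` is the stabilizer of a vertex. -/
  exists_stabilizer_eq : ∀ H ∈ ℋ, ∃ v : V, MulAction.stabilizer G v = H
  /-- Two vertices with the same non-compact stabilizer `H ∈ ℋ` are in the same orbit. -/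
  same_orbit : ∀ H ∈ ℋ, ¬ IsCompact (H : Set G) → ∀ v w : V,
    MulAction.stabilizer G v = H → MulAction.stabilizer G w = H → ∃ g : G, g • v = w

/-- `G` is hyperbolic relative to `ℋ`: `(G, ℋ)` is a proper pair that has a fine and hyperbolic
Cayley-Abels graph. (Since there are finitely many orbits of vertices, restricting the vertex set
to the universe of `G` loses nothing.) -/
def IsHyperbolicRelTo (G : Type u) [Group G] [TopologicalSpace G]
    (ℋ : Set (Subgroup G)) : Prop :=
  IsProperPair G ℋ ∧
    ∃ (V : Type u) (_ : MulAction G V) (X : SimpleGraph V),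
      IsRelCayleyAbelsGraph ℋ X ∧ IsFineGraph X ∧ IsHyperbolicGraph X

/-!
The proof glues translates of a Cayley-Abels graph of `A` along the Bass-Serre tree of the HNN
extension `G`.

If the associated subgroups `C` and `D` fix vertices `x` and `y` of a Cayley-Abels graph `X` of `A`,
take the disjoint union `G ×_A X` of the translates of `X` and join `g • y` to `g * t • x` by an edge
for each `g : G` (`hnnGraph`). These edges correspond to the edges of the Bass-Serre tree, hence each
of them is a bridge. The two sides of a bridge are told apart without normal forms, by a
function `HNNExtension.height` on `G` which is right invariant under `A` and changes between `g` and
`g * t` only if `g ∈ D`; it comes from an action of `G` on `G × ℤ`. Adding bridges preserves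
fineness, since a path between separated vertices splits at the bridge (`IsFineGraph.of_bridges`),
and it preserves the four point condition with the same constant (`IsHyperbolicGraph.of_bridges`).

In general `C` and `D` fix no vertex of `X`, but they are compact and open, so their orbits are
finite. For a compact open subgroup `K` of `A` and a vertex `x₀`, the translates of `K x₀` are coned
off, with one cone for each coset of `K` (`coneGraph`). The legs of the cones are at least as long as
the diameter of `K x₀`, so that `X` stays isometrically embedded and hyperbolicity is immediate; no
invariance of hyperbolicity under quasi-isometries is needed. For fineness, the notion used is the
local finiteness of angles (`SimpleGraph.AngleFinite`), which is equivalent to it and does not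
mention embedded paths. It passes to the cone graph (`SimpleGraph.AngleFinite.attach`) because any
two distinct vertices of `X` lie in the hulls of only finitely many cones.

The last fact, like the conditions on non-compact members of `ℋ` in the definitions of proper pairs
and Cayley-Abels graphs, follows from the compactness of the common stabilizer of two distinct
vertices of a fine graph with compact edge stabilizers
(`SimpleGraph.AngleFinite.isCompact_inter_stabilizer`).
-/

open SimpleGraph

/-! ### Bounded chains of a relation -/

/-- `StepsLE r n a b`: there is a chain of at most `n` steps of the relation `r` from `a`
to `b`. -/
inductive StepsLE {W : Type*} (r : W → W → Prop) : ℕ → W → W → Prop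
  | refl (n : ℕ) (a : W) : StepsLE r n a a
  | tail {n : ℕ} {a b c : W} : StepsLE r n a b → r b c → StepsLE r (n + 1) a c

namespace StepsLE

variable {W : Type*} {r R : W → W → Prop}

theorem succ {n : ℕ} {a b : W} (h : StepsLE r n a b) : StepsLE r (n + 1) a b := by
  induction h with
  | refl n a => exact refl _ _
  | tail _ hr ih => exact tail ih hr

theorem mono {m n : ℕ} {a b : W} (h : StepsLE r m a b) (hmn : m ≤ n) : StepsLE r n a b := by
  induction hmn with
  | refl => exact h
  | step _ ih => exact ih.succ

theorem single {a b : W} (h : r a b) : StepsLE r 1 a b := tail (refl 0 a) h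

theorem trans {m n : ℕ} {a b c : W} (h : StepsLE r m a b) (h' : StepsLE r n b c) :
    StepsLE r (m + n) a c := by
  induction h' with
  | refl n a => exact h.mono (Nat.le_add_right _ _)
  | tail _ hr ih => exact tail (ih h) hr

theorem symm (hr : ∀ a b, r a b → r b a) {n : ℕ} {a b : W} (h : StepsLE r n a b) :
    StepsLE r n b a := by
  induction h with
  | refl n a => exact refl _ _
  | tail _ h' ih => exact ((single (hr _ _ h')).trans ih).mono (by omega)

/-- A chain of two kinds of steps either uses the first kind only, or can be cut at its first step
of the second kind. -/
theorem cut_at_first_jump {n : ℕ} {s y : W} (h : StepsLE (fun a b => r a b ∨ R a b) n s y) :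
    StepsLE r n s y ∨ ∃ z₁ z₂, ∃ m < n, StepsLE r n s z₁ ∧ R z₁ z₂ ∧
      StepsLE (fun a b => r a b ∨ R a b) m z₂ y := by
  induction h with
  | refl n a => exact Or.inl (refl _ _)
  | @tail n a b c _ hbc ih =>
    rcases ih with ih | ⟨z₁, z₂, m, hm, h₁, h₂, h₃⟩
    · rcases hbc with hbc | hbc
      · exact Or.inl (ih.tail hbc)
      · exact Or.inr ⟨b, c, 0, by omega, ih.succ, hbc, refl _ _⟩
    · exact Or.inr ⟨z₁, z₂, m + 1, by omega, h₁.succ, h₂, h₃.tail hbc⟩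

/-- If `r`-balls meet `N` in finite sets, this remains true after adding a relation `R` which is
finite-to-one and relates only elements of `N`. -/
theorem finite_of_finite_jumps {N : Set W}
    (hr : ∀ s n, {y | y ∈ N ∧ StepsLE r n s y}.Finite)
    (hRN : ∀ z₁ z₂, R z₁ z₂ → z₁ ∈ N) (hR : ∀ z₁, {z₂ | R z₁ z₂}.Finite) (n : ℕ) (s : W) :
    {y | y ∈ N ∧ StepsLE (fun a b => r a b ∨ R a b) n s y}.Finite := by
  induction n using Nat.strong_induction_on generalizing s with
  | _ n ih =>
    have hfin : (⋃ z₁ ∈ {z | z ∈ N ∧ StepsLE r n s z}, ⋃ z₂ ∈ {z₂ | R z₁ z₂},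
        ⋃ m ∈ Set.Iio n,
          {y | y ∈ N ∧ StepsLE (fun a b => r a b ∨ R a b) m z₂ y}).Finite :=
      (hr s n).biUnion fun z₁ _ => (hR z₁).biUnion fun z₂ _ =>
        (Set.finite_Iio n).biUnion fun m hm => ih m hm z₂
    refine ((hr s n).union hfin).subset ?_
    rintro y ⟨hyN, hy⟩
    rcases hy.cut_at_first_jump with h | ⟨z₁, z₂, m, hm, h₁, h₂, h₃⟩
    · exact Or.inl ⟨hyN, h⟩
    · refine Or.inr ?_
      simp only [Set.mem_iUnion]
      exact ⟨z₁, ⟨hRN _ _ h₂, h₁⟩, z₂, h₂, m, hm, hyN, h₃⟩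

end StepsLE

/-! ### Fine graphs and angles -/

namespace SimpleGraph

/-- Adjacency in the graph with the vertex `v` removed. -/
def AdjAvoiding {V : Type*} (X : SimpleGraph V) (v a b : V) : Prop :=
  X.Adj a b ∧ a ≠ v ∧ b ≠ v

theorem AdjAvoiding.symm {V : Type*} {X : SimpleGraph V} {v a b : V}
    (h : X.AdjAvoiding v a b) : X.AdjAvoiding v b a :=
  ⟨h.1.symm, h.2.2, h.2.1⟩

/-- Local finiteness of the angle metrics: for all vertices `v` and `s`, only finitely many
neighbours of `v` lie within a given distance of `s` in the graph with `v` removed. -/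
def AngleFinite {V : Type*} (X : SimpleGraph V) : Prop :=
  ∀ (v s : V) (n : ℕ), {y | X.Adj v y ∧ StepsLE (X.AdjAvoiding v) n s y}.Finite

theorem Walk.stepsLE_adjAvoiding {V : Type*} {X : SimpleGraph V} {v a b : V} (p : X.Walk a b)
    (hp : v ∉ p.support) : StepsLE (X.AdjAvoiding v) p.length a b := by
  induction p with
  | nil => exact StepsLE.refl _ _
  | cons h p ih =>
    rw [Walk.support_cons, List.mem_cons, not_or] at hp
    rw [Walk.length_cons, Nat.add_comm]
    refine (StepsLE.single ⟨h, Ne.symm hp.1, ?_⟩).trans (ih hp.2)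
    rintro rfl
    exact hp.2 p.start_mem_support

theorem exists_walk_of_stepsLE {V : Type*} {X : SimpleGraph V} {v a b : V} {n : ℕ}
    (h : StepsLE (X.AdjAvoiding v) n a b) (ha : a ≠ v) :
    ∃ p : X.Walk a b, v ∉ p.support ∧ p.length ≤ n := by
  induction h with
  | refl n a => exact ⟨Walk.nil, by simpa using ha.symm, by simp⟩
  | tail _ hbc ih =>
    obtain ⟨p, hp, hl⟩ := ih ha
    refine ⟨p.concat hbc.1, ?_, by simpa using hl⟩
    rw [Walk.support_concat]
    simpa using ⟨hp, hbc.2.2.symm⟩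

theorem exists_path_of_stepsLE {V : Type*} {X : SimpleGraph V} {v a b : V} {n : ℕ}
    (h : StepsLE (X.AdjAvoiding v) n a b) (ha : a ≠ v) :
    ∃ p : X.Walk a b, p.IsPath ∧ v ∉ p.support ∧ p.length ≤ n := by
  classical
  obtain ⟨p, hp, hl⟩ := exists_walk_of_stepsLE h ha
  exact ⟨p.bypass, p.bypass_isPath, fun hv => hp (p.support_bypass_subset_support hv),
    p.length_bypass_le_length.trans hl⟩

end SimpleGraph


/-- In a fine graph the angle metrics are locally finite: a neighbour `y` of `v` at angular
distance `≤ n` from `s` is the penultimate vertex of an embedded path from `s` to `v` of length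
`≤ n + 1`. -/
theorem IsFineGraph.angleFinite {V : Type u} {X : SimpleGraph V} (hX : IsFineGraph X) :
    X.AngleFinite := by
  intro v s n
  by_cases hs : s = v
  · subst hs
    refine Set.finite_empty.subset ?_
    rintro y ⟨hy, h⟩
    have : ∀ {m a b}, StepsLE (X.AdjAvoiding s) m a b → a = s → b = s := by
      intro m a b h
      induction h with
      | refl => exact id
      | tail _ h ih => exact fun ha => absurd (ih ha) h.2.1
    exact hy.ne (this h rfl).symm
  · have hfin : (⋃ m ∈ Set.Iic (n + 1), (fun p : X.Walk s v => p.penultimate) ''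
        {p | p.IsPath ∧ p.length = m}).Finite :=
      (Set.finite_Iic _).biUnion fun m _ => (hX s v m).image _
    refine hfin.subset ?_
    rintro y ⟨hy, h⟩
    obtain ⟨p, hp, hv, hl⟩ := exists_path_of_stepsLE h hs
    simp only [Set.mem_iUnion]
    exact ⟨p.length + 1, by simpa using hl, p.concat hy.symm, ⟨hp.concat hv _, by simp⟩,
      Walk.penultimate_concat _ _⟩

theorem SimpleGraph.AngleFinite.isFineGraph {V : Type u} {X : SimpleGraph V}
    (hX : X.AngleFinite) : IsFineGraph X := by
  intro u v n
  induction n generalizing u with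
  | zero =>
    refine Set.Subsingleton.finite ?_
    rintro p ⟨-, hp⟩ q ⟨-, hq⟩
    cases p with
    | nil =>
      cases q with
      | nil => rfl
      | cons => simp at hq
    | cons => simp at hp
  | succ n ih =>
    have hfin : (⋃ y ∈ {y | X.Adj u y ∧ StepsLE (X.AdjAvoiding u) n v y},
        {p : X.Walk u v | ∃ (h : X.Adj u y) (q : X.Walk y v),
          (q.IsPath ∧ q.length = n) ∧ p = Walk.cons h q}).Finite := by
      refine (hX u v n).biUnion fun y hy => ((ih y).image (Walk.cons hy.1)).subset ?_
      rintro _ ⟨h, q, hq, rfl⟩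
      exact ⟨q, hq, rfl⟩
    refine hfin.subset ?_
    rintro p ⟨hp, hl⟩
    cases p with
    | nil => simp at hl
    | @cons _ y _ h q =>
      rw [Walk.cons_isPath_iff] at hp
      simp only [Walk.length_cons, Nat.add_right_cancel_iff] at hl
      simp only [Set.mem_iUnion]
      refine ⟨y, ⟨h, ?_⟩, h, q, ⟨hp.1, hl⟩, rfl⟩
      exact hl ▸ (q.stepsLE_adjAvoiding hp.2).symm fun _ _ => AdjAvoiding.symm

/-! ### Bridges -/

/-- `S` is the set of vertices on the `p`-side of a bridge from `p` to `q`: the only edge of `Y`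
that leaves `S` is the one from `p` to `q`. -/
structure IsBridgeSide {W : Type*} (Y : SimpleGraph W) (S : Set W) (p q : W) : Prop where
  fst_mem : p ∈ S
  snd_notMem : q ∉ S
  adj : Y.Adj p q
  eq_of_adj : ∀ a b, Y.Adj a b → a ∈ S → b ∉ S → a = p ∧ b = q

namespace IsBridgeSide

variable {W : Type*} {Y : SimpleGraph W} {S : Set W} {p q : W}

theorem compl (h : IsBridgeSide Y S p q) : IsBridgeSide Y Sᶜ q p where
  fst_mem := h.snd_notMem
  snd_notMem := fun h' => h' h.fst_mem
  adj := h.adj.symm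
  eq_of_adj a b hab ha hb := (h.eq_of_adj b a hab.symm (not_not.1 hb) ha).symm

theorem exists_append (h : IsBridgeSide Y S p q) {u v : W} (w : Y.Walk u v) (hu : u ∈ S)
    (hv : v ∉ S) : ∃ (w₁ : Y.Walk u p) (w₂ : Y.Walk q v), w = w₁.append (Walk.cons h.adj w₂) := by
  induction w with
  | nil => exact absurd hu hv
  | @cons a b c hab w ih =>
    by_cases hb : b ∈ S
    · obtain ⟨w₁, w₂, rfl⟩ := ih hb hv
      exact ⟨Walk.cons hab w₁, w₂, rfl⟩
    · obtain ⟨rfl, rfl⟩ := h.eq_of_adj _ _ hab hu hb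
      exact ⟨Walk.nil, w, rfl⟩

theorem mem_support (h : IsBridgeSide Y S p q) {u v : W} (w : Y.Walk u v) (hu : u ∈ S)
    (hv : v ∉ S) : p ∈ w.support ∧ q ∈ w.support := by
  obtain ⟨w₁, w₂, rfl⟩ := h.exists_append w hu hv
  simp [Walk.mem_support_append_iff]

theorem dist_eq (h : IsBridgeSide Y S p q) (hY : Y.Connected) {u v : W} (hu : u ∈ S)
    (hv : v ∉ S) : Y.dist u v = Y.dist u p + 1 + Y.dist q v := by
  apply le_antisymm
  · have h₁ := hY.dist_triangle (u := u) (v := p) (w := v)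
    have h₂ := hY.dist_triangle (u := p) (v := q) (w := v)
    have h₃ : Y.dist p q = 1 := SimpleGraph.dist_eq_one_iff_adj.2 h.adj
    omega
  · obtain ⟨w, hw⟩ := hY.exists_walk_length_eq_dist u v
    obtain ⟨w₁, w₂, rfl⟩ := h.exists_append w hu hv
    have h₁ := SimpleGraph.dist_le w₁
    have h₂ := SimpleGraph.dist_le w₂
    rw [← hw]
    simp only [Walk.length_append, Walk.length_cons]
    omega

end IsBridgeSide

section Bridges

variable {W : Type u} {Y₀ Y : SimpleGraph W}

/-- A path in `Y` between two vertices which are not separated by a bridge lies in `Y₀`, if all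
edges of `Y` outside `Y₀` are bridges. -/
theorem exists_map_ofLE_eq_of_isPath (hle : Y₀ ≤ Y)
    (hbr : ∀ p q, Y.Adj p q → ¬ Y₀.Adj p q → ∃ S, IsBridgeSide Y S p q)
    {u v : W} (w : Y.Walk u v) (hw : w.IsPath)
    (hsep : ∀ S p q, IsBridgeSide Y S p q → u ∈ S → v ∈ S) :
    ∃ w₀ : Y₀.Walk u v, w₀.map (.ofLE hle) = w := by
  induction w with
  | nil => exact ⟨Walk.nil, rfl⟩
  | @cons a b c hab w ih =>
    rw [Walk.cons_isPath_iff] at hw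
    by_cases h₀ : Y₀.Adj a b
    · obtain ⟨w₀, rfl⟩ := ih hw.1 fun S p q hS hb => by
        by_contra hc
        have ha : a ∉ S := fun ha => hc (hsep S p q hS ha)
        obtain ⟨rfl, rfl⟩ := hS.eq_of_adj b a hab.symm hb ha
        exact hw.2 (hS.mem_support w hb hc).2
      exact ⟨Walk.cons h₀ w₀, rfl⟩
    · obtain ⟨S, hS⟩ := hbr a b hab h₀
      have hc := hsep S a b hS hS.fst_mem
      exact absurd (hS.compl.mem_support w hS.snd_notMem (fun h => h hc)).2 hw.2

/-- A graph is fine if it becomes fine after removing a set of bridges: a path between vertices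
that are separated by a bridge splits at the bridge into two shorter paths. -/
theorem IsFineGraph.of_bridges (hle : Y₀ ≤ Y)
    (hbr : ∀ p q, Y.Adj p q → ¬ Y₀.Adj p q → ∃ S, IsBridgeSide Y S p q)
    (h₀ : IsFineGraph Y₀) : IsFineGraph Y := by
  intro u v n
  induction n using Nat.strong_induction_on generalizing u v with
  | _ n ih =>
    by_cases hsep : ∀ S p q, IsBridgeSide Y S p q → u ∈ S → v ∈ S
    · refine ((h₀ u v n).image (fun w => w.map (.ofLE hle))).subset ?_
      rintro w ⟨hw, hl⟩
      obtain ⟨w₀, rfl⟩ := exists_map_ofLE_eq_of_isPath hle hbr w hw hsep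
      exact ⟨w₀, ⟨hw.of_map, by simpa using hl⟩, rfl⟩
    · push Not at hsep
      obtain ⟨S, p, q, hS, hu, hv⟩ := hsep
      have hfin : (⋃ i ∈ Set.Iio n, ⋃ j ∈ Set.Iio n,
          (fun x : Y.Walk u p × Y.Walk q v => x.1.append (Walk.cons hS.adj x.2)) ''
          ({w | w.IsPath ∧ w.length = i} ×ˢ {w | w.IsPath ∧ w.length = j})).Finite :=
        (Set.finite_Iio n).biUnion fun i hi => (Set.finite_Iio n).biUnion fun j hj =>
          ((ih i hi u p).prod (ih j hj q v)).image _
      refine hfin.subset ?_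
      rintro w ⟨hw, hl⟩
      obtain ⟨w₁, w₂, rfl⟩ := hS.exists_append w hu hv
      simp only [Walk.length_append, Walk.length_cons] at hl
      simp only [Set.mem_iUnion]
      exact ⟨w₁.length, by simp; omega, w₂.length, by simp; omega, (w₁, w₂),
        ⟨⟨hw.of_append_left, rfl⟩, hw.of_append_right.of_cons, rfl⟩, rfl⟩

/-- The four point condition with constant `δ`, for all three ways of pairing the points. -/
def FourPoint (d : W → W → ℕ) (δ : ℕ) (x y z w : W) : Prop :=
  d x y + d z w ≤ max (d x z + d y w) (d x w + d y z) + δ ∧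
  d x z + d y w ≤ max (d x y + d z w) (d x w + d y z) + δ ∧
  d x w + d y z ≤ max (d x y + d z w) (d x z + d y w) + δ

/-- A connected graph is hyperbolic if, after removing a set of bridges, its components are
hyperbolic with a common constant. -/
theorem IsHyperbolicGraph.of_bridges (hle : Y₀ ≤ Y) (hY : Y.Connected)
    (hbr : ∀ p q, Y.Adj p q → ¬ Y₀.Adj p q → ∃ S, IsBridgeSide Y S p q) (δ : ℕ)
    (h₀ : ∀ x y z w, Y₀.Reachable x y → Y₀.Reachable x z → Y₀.Reachable x w →
      Y₀.dist x y + Y₀.dist z w ≤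
        max (Y₀.dist x z + Y₀.dist y w) (Y₀.dist x w + Y₀.dist y z) + δ) :
    IsHyperbolicGraph Y := by
  suffices H : ∀ n x y z w, Y.dist x y + Y.dist x z + Y.dist x w + Y.dist y z + Y.dist y w
      + Y.dist z w ≤ n → FourPoint Y.dist δ x y z w from
    ⟨δ, fun x y z w => (H _ x y z w le_rfl).1⟩
  intro n
  induction n with
  | zero =>
    intro x y z w h
    refine ⟨?_, ?_, ?_⟩ <;> omega
  | succ n ih =>
    intro x y z w hn
    have hcomm : ∀ a b, Y.dist a b = Y.dist b a := fun a b => Y.dist_comm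
    -- Moving a point which a bridge separates from the other three across the bridge changes the
    -- three sums by the same amount.
    have alone : ∀ S p q, IsBridgeSide Y S p q → ∀ a b c d : W, a ∈ S → b ∉ S → c ∉ S → d ∉ S →
        Y.dist a b + Y.dist a c + Y.dist a d + Y.dist b c + Y.dist b d + Y.dist c d ≤ n + 1 →
        FourPoint Y.dist δ a b c d := by
      intro S p q hS a b c d ha hb hc hd hn
      have e₁ := hS.dist_eq hY ha hb
      have e₂ := hS.dist_eq hY ha hc
      have e₃ := hS.dist_eq hY ha hd
      obtain ⟨f₁, f₂, f₃⟩ := ih q b c d (by omega)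
      refine ⟨?_, ?_, ?_⟩ <;> omega
    have pair : ∀ S p q, IsBridgeSide Y S p q → ∀ a b c d : W, a ∈ S → b ∈ S → c ∉ S → d ∉ S →
        FourPoint Y.dist δ a b c d := by
      intro S p q hS a b c d ha hb hc hd
      have e₁ := hS.dist_eq hY ha hc
      have e₂ := hS.dist_eq hY ha hd
      have e₃ := hS.dist_eq hY hb hc
      have e₄ := hS.dist_eq hY hb hd
      have t₁ := hY.dist_triangle (u := a) (v := p) (w := b)
      have t₂ := hY.dist_triangle (u := c) (v := q) (w := d)
      have c₁ := hcomm p b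
      have c₂ := hcomm c q
      refine ⟨?_, ?_, ?_⟩ <;> omega
    -- The case of a bridge with `x` on its first side and at least one point on the other side.
    have sep : ∀ S p q, IsBridgeSide Y S p q → x ∈ S → (y ∉ S ∨ z ∉ S ∨ w ∉ S) →
        FourPoint Y.dist δ x y z w := by
      intro S p q hS hx hsep
      have c₁ := hcomm x y
      have c₂ := hcomm x z
      have c₃ := hcomm x w
      have c₄ := hcomm y z
      have c₅ := hcomm y w
      have c₆ := hcomm z w
      have cS : ∀ {a}, a ∈ S → a ∉ Sᶜ := fun h h' => h' h
      by_cases hy : y ∈ S <;> by_cases hz : z ∈ S <;> by_cases hw : w ∈ S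
      · exact absurd hsep (by tauto)
      · obtain ⟨f₁, f₂, f₃⟩ := alone _ _ _ hS.compl w x y z hw (cS hx) (cS hy) (cS hz) (by omega)
        refine ⟨?_, ?_, ?_⟩ <;> omega
      · obtain ⟨f₁, f₂, f₃⟩ := alone _ _ _ hS.compl z x y w hz (cS hx) (cS hy) (cS hw) (by omega)
        refine ⟨?_, ?_, ?_⟩ <;> omega
      · exact pair _ _ _ hS x y z w hx hy hz hw
      · obtain ⟨f₁, f₂, f₃⟩ := alone _ _ _ hS.compl y x z w hy (cS hx) (cS hz) (cS hw) (by omega)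
        refine ⟨?_, ?_, ?_⟩ <;> omega
      · obtain ⟨f₁, f₂, f₃⟩ := pair _ _ _ hS x z y w hx hz hy hw
        refine ⟨?_, ?_, ?_⟩ <;> omega
      · obtain ⟨f₁, f₂, f₃⟩ := pair _ _ _ hS x w y z hx hw hy hz
        refine ⟨?_, ?_, ?_⟩ <;> omega
      · exact alone _ _ _ hS x y z w hx hy hz hw hn
    by_cases hsep : ∃ S p q, IsBridgeSide Y S p q ∧ x ∈ S ∧ (y ∉ S ∨ z ∉ S ∨ w ∉ S)
    · obtain ⟨S, p, q, hS, hx, h⟩ := hsep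
      exact sep S p q hS hx h
    -- No bridge separates any two of the points, so their distances are those of `Y₀`.
    have same : ∀ S p q, IsBridgeSide Y S p q →
        (x ∈ S ∧ y ∈ S ∧ z ∈ S ∧ w ∈ S) ∨ (x ∉ S ∧ y ∉ S ∧ z ∉ S ∧ w ∉ S) := by
      intro S p q hS
      by_cases hx : x ∈ S
      · left
        by_contra h
        exact hsep ⟨S, p, q, hS, hx, by tauto⟩
      · right
        by_contra h
        exact hsep ⟨Sᶜ, q, p, hS.compl, hx, by simp only [Set.mem_compl_iff]; tauto⟩
    have key : ∀ a b, (∀ S p q, IsBridgeSide Y S p q → a ∈ S → b ∈ S) →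
        Y₀.Reachable a b ∧ Y₀.dist a b = Y.dist a b := by
      intro a b hab
      obtain ⟨p, hp⟩ := hY.exists_walk_length_eq_dist a b
      obtain ⟨p₀, rfl⟩ :=
        exists_map_ofLE_eq_of_isPath hle hbr p (p.isPath_of_length_eq_dist hp) hab
      refine ⟨⟨p₀⟩, le_antisymm ?_ ?_⟩
      · rw [← hp, Walk.length_map]
        exact SimpleGraph.dist_le p₀
      · obtain ⟨p₁, hp₁⟩ := Reachable.exists_walk_length_eq_dist ⟨p₀⟩
        rw [← hp₁, ← p₁.length_map (.ofLE hle)]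
        exact SimpleGraph.dist_le _
    have kxy := key x y fun S p q h => by have := same S p q h; tauto
    have kxz := key x z fun S p q h => by have := same S p q h; tauto
    have kxw := key x w fun S p q h => by have := same S p q h; tauto
    have kyz := key y z fun S p q h => by have := same S p q h; tauto
    have kyw := key y w fun S p q h => by have := same S p q h; tauto
    have kzw := key z w fun S p q h => by have := same S p q h; tauto
    have g₁ := h₀ x y z w kxy.1 kxz.1 kxw.1
    have g₂ := h₀ x z y w kxz.1 kxy.1 kxw.1
    have g₃ := h₀ x w y z kxw.1 kxy.1 kxz.1
    have c₄ : Y₀.dist y z = Y₀.dist z y := Y₀.dist_comm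
    have c₅ : Y₀.dist y w = Y₀.dist w y := Y₀.dist_comm
    have c₆ : Y₀.dist z w = Y₀.dist w z := Y₀.dist_comm
    refine ⟨?_, ?_, ?_⟩ <;> omega

end Bridges

/-! ### Attaching finite pieces to a graph -/

section Attach

variable {V Z I : Type*} {X : SimpleGraph V}

/-- Two neighbours of `v` that lie, together with `v`, in a common set of the family `T`. -/
def JumpAt (X : SimpleGraph V) (T : I → Set V) (v z₁ z₂ : V) : Prop :=
  X.Adj v z₁ ∧ X.Adj v z₂ ∧ ∃ c, v ∈ T c ∧ z₁ ∈ T c ∧ z₂ ∈ T c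

/-- A walk inside `T c` can be followed avoiding `v`, up to its last vertex or, if that is `v`, to
a neighbour of `v`, by replacing each passage through `v` by a jump. The walk is read from its end
to its start. -/
theorem SimpleGraph.Walk.stepsLE_jumpAt {T : I → Set V} {v : V} {c : I} {a b : V} (p : X.Walk b a)
    (hp : ∀ x ∈ p.support, x ∈ T c) (ha : a ≠ v) :
    (b ≠ v → StepsLE (fun a b => X.AdjAvoiding v a b ∨ JumpAt X T v a b) p.length a b) ∧
    (b = v → ∃ z ∈ T c, X.Adj v z ∧
      StepsLE (fun a b => X.AdjAvoiding v a b ∨ JumpAt X T v a b) p.length a z) := by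
  induction p with
  | nil => exact ⟨fun _ => StepsLE.refl _ _, fun h => absurd h ha⟩
  | @cons b b' a h p ih =>
    simp only [Walk.support_cons, List.mem_cons, forall_eq_or_imp] at hp
    obtain ⟨ih₁, ih₂⟩ := ih hp.2 ha
    have hb' : b' ∈ T c := hp.2 _ p.start_mem_support
    refine ⟨fun hb => ?_, fun hb => ?_⟩
    · by_cases hv : b' = v
      · obtain ⟨z, hz, hvz, hs⟩ := ih₂ hv
        subst hv
        exact hs.tail (Or.inr ⟨hvz, h.symm, c, hb', hz, hp.1⟩)
      · exact (ih₁ hv).tail (Or.inl ⟨h.symm, hv, hb⟩)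
    · subst hb
      exact ⟨b', hb', h, (ih₁ h.ne.symm).succ⟩

/-- Let the graph `X'` arise from `X` by adding new vertices which form finite pieces
`κ ⁻¹' {c}`, where the piece of `c` is attached to the subset `F c` of `V`. If the points of
`F c` can be joined within a finite set `T c` in a bounded number of steps, and if any two distinct
vertices lie in only finitely many of the sets `T c`, then local finiteness of angles passes from
`X` to `X'`.

A walk in `X'` avoiding `v` is turned into a walk in `X` by replacing its excursions into a piece
`c` by walks in `T c`; the latter may pass through `v`, but a passage through `v` only relates
two neighbours of `v` in `T c`, and this relation is finite-to-one. -/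
theorem SimpleGraph.AngleFinite.attach {X' : SimpleGraph (V ⊕ Z)} (hX : X.AngleFinite)
    (κ : Z → I) (F T : I → Set V) (τ : ℕ)
    (hinl : ∀ u v, X'.Adj (Sum.inl u) (Sum.inl v) → X.Adj u v)
    (hmix : ∀ v z, X'.Adj (Sum.inl v) (Sum.inr z) → v ∈ F (κ z))
    (hinr : ∀ z z', X'.Adj (Sum.inr z) (Sum.inr z') → κ z = κ z')
    (hκ : ∀ c, {z | κ z = c}.Finite) (hT : ∀ c, (T c).Finite)
    (hwalk : ∀ c, ∀ u ∈ F c, ∀ v ∈ F c,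
      ∃ p : X.Walk u v, p.length ≤ τ ∧ ∀ x ∈ p.support, x ∈ T c)
    (hTfin : ∀ u v, u ≠ v → {c | u ∈ T c ∧ v ∈ T c}.Finite) : X'.AngleFinite := by
  have hFT : ∀ c, F c ⊆ T c := fun c x hx => by
    obtain ⟨p, -, hp⟩ := hwalk c x hx x hx
    exact hp _ p.start_mem_support
  have hF : ∀ c, (F c).Finite := fun c => (hT c).subset (hFT c)
  rintro (v | z) s n
  swap
  · refine (((hF (κ z)).image Sum.inl).union ((hκ (κ z)).image Sum.inr)).subset ?_
    rintro (y | y) ⟨hy, -⟩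
    · exact Or.inl ⟨y, hmix _ _ hy.symm, rfl⟩
    · exact Or.inr ⟨y, (hinr _ _ hy).symm, rfl⟩
  set Q : V → V → Prop := fun a b => X.AdjAvoiding v a b ∨ JumpAt X T v a b with hQ
  have hB : ∀ m a, {y | X.Adj v y ∧ StepsLE Q m a y}.Finite := fun m a => by
    refine StepsLE.finite_of_finite_jumps (N := {y | X.Adj v y}) (fun s n => hX v s n)
      (fun _ _ h => h.1) (fun z₁ => ?_) m a
    by_cases hz : v = z₁
    · refine Set.finite_empty.subset ?_
      rintro z₂ ⟨h, -⟩
      exact h.ne hz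
    · refine ((hTfin v z₁ hz).biUnion fun c _ => hT c).subset ?_
      rintro z₂ ⟨-, -, c, h₁, h₂, h₃⟩
      simp only [Set.mem_iUnion]
      exact ⟨c, ⟨h₁, h₂⟩, h₃⟩
  let St : Set V := Sum.elim (fun a => {a}) (fun z => F (κ z)) s
  have hSt : St.Finite := by
    rcases s with a | z
    · exact Set.finite_singleton a
    · exact hF (κ z)
  have lift : ∀ {m y'}, StepsLE (X'.AdjAvoiding (Sum.inl v)) m s y' →
      (∀ y, y' = Sum.inl y → ∃ a ∈ St, StepsLE Q (m * (τ + 1)) a y) ∧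
      (∀ z, y' = Sum.inr z → (∃ a ∈ St, ∃ w ∈ F (κ z), w ≠ v ∧ StepsLE Q (m * (τ + 1)) a w) ∨
        ∃ z₀, s = Sum.inr z₀ ∧ κ z₀ = κ z) := by
    intro m y' h
    generalize hs : s = s' at h
    induction h with
    | refl m a =>
      subst hs
      refine ⟨fun y hy => ⟨y, ?_, StepsLE.refl _ _⟩, fun z hz => Or.inr ⟨z, hz, rfl⟩⟩
      subst hy
      exact Set.mem_singleton y
    | @tail m a b c _ hbc ih =>
      obtain ⟨ih₁, ih₂⟩ := ih hs
      have hmul : (m + 1) * (τ + 1) = m * (τ + 1) + (τ + 1) := by ring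
      obtain ⟨hadj, hbv, hcv⟩ := hbc
      subst hs
      rcases b with b | b
      · obtain ⟨a, ha, hab⟩ := ih₁ b rfl
        have hbv' : b ≠ v := fun h => hbv (congrArg _ h)
        refine ⟨?_, ?_⟩
        · rintro y rfl
          refine ⟨a, ha, (hab.tail (Or.inl ⟨hinl _ _ hadj, hbv', fun h => ?_⟩)).mono ?_⟩
          · exact hcv (congrArg _ h)
          · omega
        · rintro z rfl
          exact Or.inl ⟨a, ha, b, hmix _ _ hadj, hbv', hab.mono (by omega)⟩
      · refine ⟨?_, ?_⟩
        · rintro y rfl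
          have hy := hmix _ _ hadj.symm
          have hyv : y ≠ v := fun h => hcv (congrArg _ h)
          rcases ih₂ b rfl with ⟨a, ha, w, hw, hwv, haw⟩ | ⟨z₀, rfl, hz₀⟩
          · obtain ⟨p, hpl, hp⟩ := hwalk _ _ hy _ hw
            refine ⟨a, ha, (haw.trans ((p.stepsLE_jumpAt hp hwv).1 hyv)).mono ?_⟩
            omega
          · refine ⟨y, ?_, StepsLE.refl _ _⟩
            change y ∈ F (κ z₀)
            rwa [hz₀]
        · rintro z rfl
          rw [← hinr _ _ hadj]
          rcases ih₂ b rfl with ⟨a, ha, w, hw, hwv, haw⟩ | h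
          · exact Or.inl ⟨a, ha, w, hw, hwv, haw.mono (by omega)⟩
          · exact Or.inr h
  have hfin₁ : (⋃ a ∈ St, {y | X.Adj v y ∧ StepsLE Q (n * (τ + 1)) a y}).Finite :=
    hSt.biUnion fun a _ => hB _ a
  have hfin₂ : (⋃ a ∈ St, ⋃ z₁ ∈ {y | X.Adj v y ∧ StepsLE Q (n * (τ + 1) + τ) a y},
      ⋃ c ∈ {c | v ∈ T c ∧ z₁ ∈ T c}, {z | κ z = c}).Finite :=
    hSt.biUnion fun a _ => (hB _ a).biUnion fun z₁ hz₁ =>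
      (hTfin v z₁ hz₁.1.ne).biUnion fun c _ => hκ c
  have hfin₃ : {z | ∃ z₀, s = Sum.inr z₀ ∧ κ z₀ = κ z}.Finite := by
    rcases s with a | z₀
    · exact Set.finite_empty.subset fun z ⟨z₀, h, _⟩ => by simp at h
    · refine (hκ (κ z₀)).subset ?_
      rintro z ⟨z₁, h, h'⟩
      rw [Sum.inr.inj h]
      exact h'.symm
  refine ((hfin₁.image Sum.inl).union ((hfin₂.union hfin₃).image Sum.inr)).subset ?_
  rintro (y | z) ⟨hadj, hst⟩
  · obtain ⟨a, ha, hay⟩ := (lift hst).1 y rfl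
    refine Or.inl ⟨y, ?_, rfl⟩
    simp only [Set.mem_iUnion]
    exact ⟨a, ha, hinl _ _ hadj, hay⟩
  · refine Or.inr ⟨z, ?_, rfl⟩
    rcases (lift hst).2 z rfl with ⟨a, ha, w, hw, hwv, haw⟩ | h
    · left
      have hv := hmix _ _ hadj
      obtain ⟨p, hpl, hp⟩ := hwalk _ _ hv _ hw
      obtain ⟨z₁, hz₁, hvz₁, hs⟩ := (p.stepsLE_jumpAt hp hwv).2 rfl
      simp only [Set.mem_iUnion]
      exact ⟨a, ha, z₁, ⟨hvz₁, (haw.trans hs).mono (by omega)⟩, κ z, ⟨hFT _ hv, hz₁⟩, rfl⟩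
    · exact Or.inr h

end Attach

/-! ### Discrete actions of topological groups on graphs -/

section Actions

variable {G : Type*} [Group G] [TopologicalSpace G] [IsTopologicalGroup G]
  {V : Type*} [MulAction G V]

theorem isOpen_setOf_smul_eq {x : V} (hx : IsOpen (MulAction.stabilizer G x : Set G)) (y : V) :
    IsOpen {g : G | g • x = y} := by
  by_cases h : ∃ g₀ : G, g₀ • x = y
  · obtain ⟨g₀, rfl⟩ := h
    convert hx.preimage (continuous_const_mul g₀⁻¹) using 1
    ext g
    simp [MulAction.mem_stabilizer_iff, mul_smul, inv_smul_eq_iff]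
  · convert isOpen_empty
    ext g
    simpa using fun hg => h ⟨g, hg⟩

theorem isClosed_stabilizer {x : V} (hx : IsOpen (MulAction.stabilizer G x : Set G)) :
    IsClosed (MulAction.stabilizer G x : Set G) :=
  Subgroup.isClosed_of_isOpen _ hx

/-- The orbit of a point with open stabilizer under a compact set is finite. -/
theorem IsCompact.finite_image_smul {x : V} (hx : IsOpen (MulAction.stabilizer G x : Set G))
    {K : Set G} (hK : IsCompact K) : ((fun g : G => g • x) '' K).Finite := by
  obtain ⟨t, ht⟩ := hK.elim_finite_subcover (fun y : V => {g : G | g • x = y})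
    (isOpen_setOf_smul_eq hx) fun g _ => Set.mem_iUnion.2 ⟨g • x, rfl⟩
  refine t.finite_toSet.subset ?_
  rintro _ ⟨g, hg, rfl⟩
  obtain ⟨y, hy, h⟩ := Set.mem_iUnion₂.1 (ht hg)
  have h' : g • x = y := h
  exact (congrArg (· ∈ (t : Set V)) h').mpr hy

theorem isCompact_setOf_smul_eq_and_smul_eq {x y : V}
    (h : IsCompact (MulAction.stabilizer G x ∩ MulAction.stabilizer G y : Set G)) (x' y' : V) :
    IsCompact {g : G | g • x = x' ∧ g • y = y'} := by
  by_cases hg : ∃ g₀ : G, g₀ • x = x' ∧ g₀ • y = y'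
  · obtain ⟨g₀, rfl, rfl⟩ := hg
    convert h.image (continuous_const_mul g₀) using 1
    ext g
    simp only [Set.mem_ofPred_eq, Set.image_mul_left, Set.mem_preimage, Set.mem_inter_iff,
      SetLike.mem_coe, MulAction.mem_stabilizer_iff, mul_smul, inv_smul_eq_iff]
  · convert isCompact_empty
    ext g
    simpa using fun h₁ h₂ => hg ⟨g, h₁, h₂⟩

variable {X : SimpleGraph V}

/-- In a connected graph with locally finite angles, on which a group acts with open vertex
stabilizers and compact pointwise stabilizers of edges, the common stabilizer `P` of two distinct
vertices `u` and `v` is compact. Indeed, if `y` is the first vertex after `u` on a path from `u`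
to `v`, the orbit of `y` under `P` consists of neighbours of `u` at bounded angle from `v`, so `P`
is covered by finitely many cosets of the stabilizer of the edge from `u` to `y`. -/
theorem SimpleGraph.AngleFinite.isCompact_inter_stabilizer (hX : X.AngleFinite)
    (hconn : X.Connected) (hadj : ∀ (g : G) (u v : V), X.Adj u v → X.Adj (g • u) (g • v))
    (hopen : ∀ v : V, IsOpen (MulAction.stabilizer G v : Set G))
    (hedge : ∀ u v : V, X.Adj u v →
      IsCompact (MulAction.stabilizer G u ∩ MulAction.stabilizer G v : Set G))
    {u v : V} (huv : u ≠ v) :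
    IsCompact (MulAction.stabilizer G u ∩ MulAction.stabilizer G v : Set G) := by
  obtain ⟨p, hp, -⟩ := hconn.exists_path_of_dist u v
  cases p with
  | nil => exact absurd rfl huv
  | @cons _ y _ h q =>
    rw [Walk.cons_isPath_iff] at hp
    have hs : StepsLE (X.AdjAvoiding u) q.length v y :=
      (q.stepsLE_adjAvoiding hp.2).symm fun _ _ => AdjAvoiding.symm
    have hmap : ∀ g : G, g • u = u → ∀ {n a b}, StepsLE (X.AdjAvoiding u) n a b →
        StepsLE (X.AdjAvoiding u) n (g • a) (g • b) := by
      intro g hg n a b hab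
      induction hab with
      | refl n a => exact StepsLE.refl _ _
      | tail _ h ih =>
        refine ih.tail ⟨hadj g _ _ h.1, ?_, ?_⟩
        · rw [← hg, Ne, smul_left_cancel_iff]
          exact h.2.1
        · rw [← hg, Ne, smul_left_cancel_iff]
          exact h.2.2
    have hcov : IsCompact (⋃ z ∈ {z | X.Adj u z ∧ StepsLE (X.AdjAvoiding u) q.length v z},
        {g : G | g • u = u ∧ g • y = z}) :=
      (hX u v q.length).isCompact_biUnion fun z _ =>
        isCompact_setOf_smul_eq_and_smul_eq (hedge u y h) u z
    refine hcov.of_isClosed_subset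
      ((isClosed_stabilizer (hopen u)).inter (isClosed_stabilizer (hopen v))) ?_
    rintro g ⟨hgu, hgv⟩
    have hgu' : g • u = u := hgu
    have hgv' : g • v = v := hgv
    simp only [Set.mem_iUnion]
    refine ⟨g • y, ⟨?_, ?_⟩, hgu', rfl⟩
    · simpa only [hgu'] using hadj g u y h
    · simpa only [hgv'] using hmap g hgu' hs

end Actions

namespace IsRelCayleyAbelsGraph

variable {G : Type u} [Group G] [TopologicalSpace G] {ℋ : Set (Subgroup G)}
  {V : Type u} [MulAction G V] {X : SimpleGraph V}

theorem exists_finite_edge_orbits (hX : IsRelCayleyAbelsGraph ℋ X) :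
    ∃ F : Set (V × V), F.Finite ∧ ∀ u v, X.Adj u v → ∃ g : G, ∃ e ∈ F,
      (u = g • e.1 ∧ v = g • e.2) ∨ (u = g • e.2 ∧ v = g • e.1) := by
  obtain ⟨F, hF, h⟩ := hX.finite_edge_orbits
  refine ⟨(fun e : Sym2 V => e.out) '' F, hF.image _, fun u v huv => ?_⟩
  obtain ⟨g, f, hf, hg⟩ := h s(u, v) huv
  refine ⟨g, f.out, ⟨f, hf, rfl⟩, ?_⟩
  have hf' : f = s(f.out.1, f.out.2) := (Quot.out_eq f).symm
  rw [hf', Sym2.map_mk, Sym2.eq_iff] at hg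
  exact hg

variable [IsTopologicalGroup G]

theorem isCompact_of_adj (hX : IsRelCayleyAbelsGraph ℋ X) (u v : V) (h : X.Adj u v) :
    IsCompact (MulAction.stabilizer G u ∩ MulAction.stabilizer G v : Set G) := by
  refine (hX.isCompact_edge_stabilizer s(u, v) h).of_isClosed_subset
    ((isClosed_stabilizer (hX.isOpen_stabilizer u)).inter
      (isClosed_stabilizer (hX.isOpen_stabilizer v))) ?_
  rintro g ⟨hgu, hgv⟩
  have hgu' : g • u = u := hgu
  have hgv' : g • v = v := hgv
  simp [hgu', hgv']

theorem isCompact_of_ne (hX : IsRelCayleyAbelsGraph ℋ X) (hfine : IsFineGraph X) {u v : V}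
    (h : u ≠ v) : IsCompact (MulAction.stabilizer G u ∩ MulAction.stabilizer G v : Set G) :=
  hfine.angleFinite.isCompact_inter_stabilizer hX.connected hX.smul_adj hX.isOpen_stabilizer
    hX.isCompact_of_adj h

/-- In a fine Cayley-Abels graph a vertex is determined by its stabilizer if that is
non-compact. -/
theorem eq_of_stabilizer_eq (hX : IsRelCayleyAbelsGraph ℋ X) (hfine : IsFineGraph X) {u v : V}
    (h : MulAction.stabilizer G u = MulAction.stabilizer G v)
    (hc : ¬ IsCompact (MulAction.stabilizer G u : Set G)) : u = v := by
  by_contra huv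
  have := hX.isCompact_of_ne hfine huv
  rw [← h, Set.inter_self] at this
  exact hc this

/-- A criterion for Cayley-Abels graphs with locally finite angles, in terms of pairs of adjacent
vertices; the condition on vertices with the same stabilizer is then automatic. -/
theorem of_angleFinite (hangle : X.AngleFinite) (hconn : X.Connected)
    (hadj : ∀ (g : G) (u v : V), X.Adj u v → X.Adj (g • u) (g • v))
    (hvert : ∃ F : Set V, F.Finite ∧ ∀ v : V, ∃ g : G, ∃ w ∈ F, v = g • w)
    (hedges : ∃ F : Set (V × V), F.Finite ∧ ∀ u v, X.Adj u v → ∃ g : G, ∃ e ∈ F,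
      (u = g • e.1 ∧ v = g • e.2) ∨ (u = g • e.2 ∧ v = g • e.1))
    (hopen : ∀ v : V, IsOpen (MulAction.stabilizer G v : Set G))
    (hedge : ∀ u v : V, X.Adj u v →
      IsCompact (MulAction.stabilizer G u ∩ MulAction.stabilizer G v : Set G))
    (hstab : ∀ v : V, IsCompact (MulAction.stabilizer G v : Set G) ∨
      ∃ H ∈ ℋ, ∃ g : G, MulAction.stabilizer G v = conjSubgroup g H)
    (hexists : ∀ H ∈ ℋ, ∃ v : V, MulAction.stabilizer G v = H) : IsRelCayleyAbelsGraph ℋ X where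
  connected := hconn
  smul_adj := hadj
  finite_vertex_orbits := hvert
  finite_edge_orbits := by
    obtain ⟨F, hF, h⟩ := hedges
    refine ⟨(fun e : V × V => s(e.1, e.2)) '' F, hF.image _, fun e he => ?_⟩
    induction e using Sym2.ind with
    | _ u v =>
      obtain ⟨g, e, heF, h'⟩ := h u v he
      refine ⟨g, _, ⟨e, heF, rfl⟩, ?_⟩
      rw [Sym2.map_mk, Sym2.eq_iff]
      exact h'
  isOpen_stabilizer := hopen
  isCompact_edge_stabilizer e he := by
    induction e using Sym2.ind with
    | _ u v =>
      have h := hedge u v he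
      convert (isCompact_setOf_smul_eq_and_smul_eq h u v).union
        (isCompact_setOf_smul_eq_and_smul_eq h v u) using 1
      ext g
      simp
  vertex_stabilizer := hstab
  exists_stabilizer_eq := hexists
  same_orbit H _ hc v w hv hw := by
    refine ⟨1, ?_⟩
    rw [one_smul]
    by_contra hvw
    have := hangle.isCompact_inter_stabilizer hconn hadj hopen hedge hvw
    rw [hv, hw, Set.inter_self] at this
    exact hc this

end IsRelCayleyAbelsGraph

/-! ### Distances -/

namespace SimpleGraph

theorem le_add_dist_of_adj {W : Type*} {Y : SimpleGraph W} (hY : Y.Connected) {f : W → ℕ}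
    (hf : ∀ a b, Y.Adj a b → f b ≤ f a + 1) (a b : W) : f b ≤ f a + Y.dist a b := by
  obtain ⟨p, hp⟩ := hY.exists_walk_length_eq_dist a b
  rw [← hp]
  clear hp
  induction p with
  | nil => simp
  | cons h p ih =>
    have := hf _ _ h
    rw [Walk.length_cons]
    omega

theorem dist_map_le {V W : Type*} {X : SimpleGraph V} {Y : SimpleGraph W} (f : X →g Y) {u v : V}
    (h : X.Reachable u v) : Y.dist (f u) (f v) ≤ X.dist u v := by
  obtain ⟨p, hp⟩ := h.exists_walk_length_eq_dist
  rw [← hp, ← p.length_map f]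
  exact dist_le _

theorem dist_smul {G V : Type*} [Group G] [MulAction G V] {X : SimpleGraph V}
    (hX : X.Connected) (hadj : ∀ (g : G) (u v : V), X.Adj u v → X.Adj (g • u) (g • v))
    (g : G) (u v : V) : X.dist (g • u) (g • v) = X.dist u v := by
  have h : ∀ (g : G) (u v : V), X.dist (g • u) (g • v) ≤ X.dist u v := fun g u v =>
    dist_map_le (⟨fun x => g • x, fun h => hadj g _ _ h⟩ : X →g X) (hX u v)
  refine le_antisymm (h g u v) ?_
  simpa using h g⁻¹ (g • u) (g • v)

/-- The union of the geodesics from `u` to `v`. -/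
def interval {V : Type*} (X : SimpleGraph V) (u v : V) : Set V :=
  {x | X.dist u x + X.dist x v = X.dist u v}

theorem mem_interval_of_mem_support {V : Type*} {X : SimpleGraph V} {u v x : V} (p : X.Walk u v)
    (hp : p.length = X.dist u v) (hx : x ∈ p.support) : x ∈ X.interval u v := by
  classical
  have h : (p.takeUntil x hx).length + (p.dropUntil x hx).length = p.length := by
    rw [← Walk.length_append, Walk.take_spec]
  have h₁ := dist_le (p.takeUntil x hx)
  have h₂ := dist_le (p.dropUntil x hx)
  obtain ⟨q₁, hq₁⟩ := Reachable.exists_walk_length_eq_dist ⟨p.takeUntil x hx⟩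
  obtain ⟨q₂, hq₂⟩ := Reachable.exists_walk_length_eq_dist ⟨p.dropUntil x hx⟩
  have h₃ := dist_le (q₁.append q₂)
  rw [Walk.length_append] at h₃
  change X.dist u x + X.dist x v = X.dist u v
  omega

end SimpleGraph

theorem IsFineGraph.finite_interval {V : Type u} {X : SimpleGraph V} (hX : IsFineGraph X)
    (hconn : X.Connected) (u v : V) : (X.interval u v).Finite := by
  refine ((hX u v (X.dist u v)).biUnion fun p _ => p.support.finite_toSet).subset ?_
  intro x hx
  obtain ⟨p, hp⟩ := hconn.exists_walk_length_eq_dist u x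
  obtain ⟨q, hq⟩ := hconn.exists_walk_length_eq_dist x v
  have hl : (p.append q).length = X.dist u v := by
    rw [Walk.length_append, hp, hq]
    exact hx
  simp only [Set.mem_iUnion]
  exact ⟨p.append q, ⟨(p.append q).isPath_of_length_eq_dist hl, hl⟩, by
    simp [Walk.mem_support_append_iff]⟩

/-! ### Stabilizers -/

theorem isOpen_conjSubgroup {G : Type u} [Group G] [TopologicalSpace G] [IsTopologicalGroup G]
    {H : Subgroup G} (hH : IsOpen (H : Set G)) (g : G) : IsOpen (conjSubgroup g H : Set G) :=
  ((Homeomorph.mulLeft g).trans (Homeomorph.mulRight g⁻¹)).isOpenMap _ hH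

theorem isCompact_conjSubgroup {G : Type u} [Group G] [TopologicalSpace G] [IsTopologicalGroup G]
    {H : Subgroup G} (hH : IsCompact (H : Set G)) (g : G) :
    IsCompact (conjSubgroup g H : Set G) :=
  hH.image ((Homeomorph.mulLeft g).trans (Homeomorph.mulRight g⁻¹)).continuous

theorem stabilizer_smul_eq_conjSubgroup {G : Type u} [Group G] {V : Type*} [MulAction G V] (g : G)
    (x : V) : MulAction.stabilizer G (g • x) = conjSubgroup g (MulAction.stabilizer G x) :=
  MulAction.stabilizer_smul_eq_stabilizer_map_conj g x

theorem stabilizer_quotient_mk {G : Type u} [Group G] (K : Subgroup G) (g : G) :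
    MulAction.stabilizer G (g : G ⧸ K) = conjSubgroup g K := by
  rw [← MulAction.stabilizer_quotient K, ← stabilizer_smul_eq_conjSubgroup,
    MulAction.stabilizer_quotient]
  congr 1
  simp

/-! ### Coning off the orbit of a compact open subgroup -/

/-- The new vertices of the cone graph: for each coset `c` of `K` an apex, which is joined to each
point of the translate of the `K`-orbit of `x₀` that belongs to `c` by a leg with `M + 1` interior
vertices. The legs are indexed by the pairs consisting of a coset and one of its points, that is,
by the orbit of `(K, x₀)`. -/
inductive ConePart {A V : Type u} [Group A] [MulAction A V] (K : Subgroup A) (x₀ : V) (M : ℕ) :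
    Type u
  | leg (e : MulAction.orbit A (((1 : A) : A ⧸ K), x₀)) (i : Fin (M + 1)) : ConePart K x₀ M
  | apex (c : A ⧸ K) : ConePart K x₀ M

namespace ConePart

variable {A V : Type u} [Group A] [MulAction A V] {K : Subgroup A} {x₀ : V} {M : ℕ}

instance : MulAction A (ConePart K x₀ M) where
  smul a z := match z with
    | leg e i => leg (a • e) i
    | apex c => apex (a • c)
  one_smul z := by
    cases z with
    | leg e i => exact congrArg (leg · i) (one_smul A e)
    | apex c => exact congrArg apex (one_smul A c)
  mul_smul a b z := by
    cases z with
    | leg e i => exact congrArg (leg · i) (mul_smul a b e)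
    | apex c => exact congrArg apex (mul_smul a b c)

theorem smul_leg (a : A) (e : MulAction.orbit A (((1 : A) : A ⧸ K), x₀)) (i : Fin (M + 1)) :
    a • (leg e i : ConePart K x₀ M) = leg (a • e) i := rfl

theorem smul_apex (a : A) (c : A ⧸ K) : a • (apex c : ConePart K x₀ M) = apex (a • c) := rfl

/-- The coset to which a vertex of a cone belongs. -/
def coset : ConePart K x₀ M → A ⧸ K
  | leg e _ => e.1.1
  | apex c => c

theorem coset_smul (a : A) (z : ConePart K x₀ M) : (a • z).coset = a • z.coset := by
  cases z <;> rfl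

theorem stabilizer_le (z : ConePart K x₀ M) :
    MulAction.stabilizer A z ≤ MulAction.stabilizer A z.coset := by
  intro a ha
  rw [MulAction.mem_stabilizer_iff] at ha ⊢
  rw [← coset_smul, ha]

/-- The leg from `x₀` to the apex of `K`. -/
def baseLeg (K : Subgroup A) (x₀ : V) : MulAction.orbit A (((1 : A) : A ⧸ K), x₀) :=
  ⟨_, MulAction.mem_orbit_self _⟩

theorem exists_smul_baseLeg (e : MulAction.orbit A (((1 : A) : A ⧸ K), x₀)) :
    ∃ a : A, e = a • baseLeg K x₀ := by
  obtain ⟨e, a, rfl⟩ := e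
  exact ⟨a, rfl⟩

/-- The feet of the cone of the coset `c`. -/
def feet (K : Subgroup A) (x₀ : V) (c : A ⧸ K) : Set V :=
  {w | ∃ e : MulAction.orbit A (((1 : A) : A ⧸ K), x₀), e.1.1 = c ∧ e.1.2 = w}

theorem mem_feet_mk {a : A} {w : V} :
    w ∈ feet K x₀ (a : A ⧸ K) ↔ ∃ k ∈ K, w = a • k • x₀ := by
  constructor
  · rintro ⟨⟨_, b, rfl⟩, h, rfl⟩
    have h' : ((b * 1 : A) : A ⧸ K) = a := h
    refine ⟨a⁻¹ * b, ?_, ?_⟩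
    · rw [mul_one] at h'
      exact QuotientGroup.eq.1 h'.symm
    · simp [mul_smul]
  · rintro ⟨k, hk, rfl⟩
    refine ⟨(a * k) • baseLeg K x₀, ?_, ?_⟩
    · change ((a * k * 1 : A) : A ⧸ K) = a
      rw [mul_one]
      exact QuotientGroup.mk_mul_of_mem a hk
    · exact mul_smul _ _ _

end ConePart

/-- The oriented edges of the cone graph. -/
inductive ConeStep {A V : Type u} [Group A] [MulAction A V] (X : SimpleGraph V) (K : Subgroup A)
    (x₀ : V) (M : ℕ) : V ⊕ ConePart K x₀ M → V ⊕ ConePart K x₀ M → Prop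
  | base {u v : V} (h : X.Adj u v) : ConeStep X K x₀ M (Sum.inl u) (Sum.inl v)
  | foot (e : MulAction.orbit A (((1 : A) : A ⧸ K), x₀)) :
      ConeStep X K x₀ M (Sum.inl e.1.2) (Sum.inr (.leg e 0))
  | up (e : MulAction.orbit A (((1 : A) : A ⧸ K), x₀)) (i : Fin M) :
      ConeStep X K x₀ M (Sum.inr (.leg e i.castSucc)) (Sum.inr (.leg e i.succ))
  | top (e : MulAction.orbit A (((1 : A) : A ⧸ K), x₀)) :
      ConeStep X K x₀ M (Sum.inr (.leg e (Fin.last M))) (Sum.inr (.apex e.1.1))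

/-- The graph obtained from `X` by coning off, for each coset `c` of `K`, the translate of the
`K`-orbit of `x₀` that belongs to `c`, with legs of length `M + 2`. -/
def coneGraph {A V : Type u} [Group A] [MulAction A V] (X : SimpleGraph V) (K : Subgroup A)
    (x₀ : V) (M : ℕ) : SimpleGraph (V ⊕ ConePart K x₀ M) where
  Adj a b := ConeStep X K x₀ M a b ∨ ConeStep X K x₀ M b a
  symm := ⟨fun _ _ h => h.symm⟩
  loopless := ⟨by
    have : ∀ a b, ConeStep X K x₀ M a b → a ≠ b := by
      rintro _ _ (h | _ | ⟨e, i⟩ | _)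
      · simpa using h.ne
      · simp
      · simp [Fin.ext_iff]
      · simp
    exact fun a h => h.elim (fun h => this a a h rfl) (fun h => this a a h rfl)⟩

namespace coneGraph

open ConePart

variable {A V : Type u} [Group A] [MulAction A V] {X : SimpleGraph V} {K : Subgroup A}
  {x₀ : V} {M : ℕ}

theorem adj_of_step {p q : V ⊕ ConePart K x₀ M} (h : ConeStep X K x₀ M p q) :
    (coneGraph X K x₀ M).Adj p q := Or.inl h

theorem adj_inl {u v : V} :
    (coneGraph X K x₀ M).Adj (Sum.inl u) (Sum.inl v) ↔ X.Adj u v := by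
  constructor
  · rintro (⟨⟨h⟩⟩ | ⟨⟨h⟩⟩)
    · assumption
    · exact SimpleGraph.Adj.symm (by assumption)
  · exact fun h => Or.inl (.base h)

theorem mem_feet_of_adj {v : V} {z : ConePart K x₀ M}
    (h : (coneGraph X K x₀ M).Adj (Sum.inl v) (Sum.inr z)) : v ∈ feet K x₀ z.coset := by
  rcases h with h | h
  · cases h with
    | foot e => exact ⟨e, rfl, rfl⟩
  · cases h

theorem coset_eq_of_adj {z z' : ConePart K x₀ M}
    (h : (coneGraph X K x₀ M).Adj (Sum.inr z) (Sum.inr z')) : z.coset = z'.coset := by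
  rcases h with h | h <;> cases h <;> rfl

theorem adj_smul (hadj : ∀ (a : A) (u v : V), X.Adj u v → X.Adj (a • u) (a • v)) (a : A)
    (p q : V ⊕ ConePart K x₀ M) (h : (coneGraph X K x₀ M).Adj p q) :
    (coneGraph X K x₀ M).Adj (a • p) (a • q) := by
  have : ∀ p q, ConeStep X K x₀ M p q → ConeStep X K x₀ M (a • p) (a • q) := by
    rintro _ _ (h | e | ⟨e, i⟩ | e)
    · exact .base (hadj a _ _ h)
    · exact .foot (a • e)
    · exact .up (a • e) i
    · exact .top (a • e)
  exact h.imp (this _ _) (this _ _)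

/-- The inclusion of `X` into the cone graph. -/
def inlHom (X : SimpleGraph V) (K : Subgroup A) (x₀ : V) (M : ℕ) : X →g coneGraph X K x₀ M where
  toFun := Sum.inl
  map_rel' h := adj_inl.2 h

theorem exists_walk_leg (e : MulAction.orbit A (((1 : A) : A ⧸ K), x₀)) (i : Fin (M + 1)) :
    ∃ p : (coneGraph X K x₀ M).Walk (Sum.inl e.1.2) (Sum.inr (.leg e i)),
      p.length = i + 1 := by
  induction i using Fin.induction with
  | zero => exact ⟨Walk.cons (adj_of_step (.foot e)) Walk.nil, rfl⟩
  | succ i ih =>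
    obtain ⟨p, hp⟩ := ih
    exact ⟨p.concat (adj_of_step (.up e i)), by simpa using hp⟩

/-- Every vertex is at distance at most `M + 2` from the base graph. -/
theorem exists_walk_inl (p : V ⊕ ConePart K x₀ M) :
    ∃ (v : V) (w : (coneGraph X K x₀ M).Walk (Sum.inl v) p), w.length ≤ M + 2 := by
  rcases p with v | e | c
  · exact ⟨v, Walk.nil, by simp⟩
  · rename_i i
    obtain ⟨w, hw⟩ := exists_walk_leg (X := X) e i
    exact ⟨_, w, by omega⟩
  · obtain ⟨a, rfl⟩ := QuotientGroup.mk_surjective c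
    obtain ⟨w, hw⟩ := exists_walk_leg (X := X) (M := M) (a • baseLeg K x₀) (Fin.last M)
    have hc : (a • baseLeg K x₀).1.1 = (a : A ⧸ K) := by
      change ((a * 1 : A) : A ⧸ K) = a
      rw [mul_one]
    rw [← hc]
    exact ⟨_, w.concat (adj_of_step (.top _)), by rw [Walk.length_concat, hw]; simp⟩

theorem connected (hX : X.Connected) : (coneGraph X K x₀ M).Connected := by
  have : Nonempty (V ⊕ ConePart K x₀ M) := ⟨Sum.inl x₀⟩
  refine ⟨fun p q => ?_⟩
  obtain ⟨u, w₁, -⟩ := exists_walk_inl (X := X) p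
  obtain ⟨v, w₂, -⟩ := exists_walk_inl (X := X) q
  exact w₁.reachable.symm.trans (((hX u v).map (inlHom X K x₀ M)).trans w₂.reachable)

theorem dist_le_of_mem_feet (hX : X.Connected)
    (hadj : ∀ (a : A) (u v : V), X.Adj u v → X.Adj (a • u) (a • v))
    (hM : ∀ k ∈ K, X.dist x₀ (k • x₀) ≤ M) {c : A ⧸ K} {v w : V} (hv : v ∈ feet K x₀ c)
    (hw : w ∈ feet K x₀ c) : X.dist v w ≤ M := by
  obtain ⟨a, rfl⟩ := QuotientGroup.mk_surjective c
  obtain ⟨k, hk, rfl⟩ := mem_feet_mk.1 hv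
  obtain ⟨l, hl, rfl⟩ := mem_feet_mk.1 hw
  rw [SimpleGraph.dist_smul hX hadj, ← SimpleGraph.dist_smul hX hadj k⁻¹, inv_smul_smul, smul_smul]
  exact hM _ (K.mul_mem (K.inv_mem hk) hl)

/-- Extension to the cone graph of the distance to the vertex `v₀` of `X`. The value at an apex is
the minimum over the feet of its cone, and along a leg the values descend to this minimum (which
also absorbs the truncation of the subtraction). If the legs are at least as long as the diameter
of the set of feet, the values at adjacent vertices differ by at most `1`. -/
noncomputable def distExt (X : SimpleGraph V) (K : Subgroup A) (x₀ : V) (M : ℕ) (v₀ : V) :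
    V ⊕ ConePart K x₀ M → ℕ
  | Sum.inl v => X.dist v₀ v
  | Sum.inr (.leg e i) => max (sInf (X.dist v₀ '' feet K x₀ e.1.1)) (X.dist v₀ e.1.2 - (i + 1))
  | Sum.inr (.apex c) => sInf (X.dist v₀ '' feet K x₀ c)

/-- Since the legs of the cones are long, `X` is isometrically embedded in the cone graph. -/
theorem dist_inl (hX : X.Connected)
    (hadj : ∀ (a : A) (u v : V), X.Adj u v → X.Adj (a • u) (a • v))
    (hM : ∀ k ∈ K, X.dist x₀ (k • x₀) ≤ M) (u v : V) :
    (coneGraph X K x₀ M).dist (Sum.inl u) (Sum.inl v) = X.dist u v := by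
  refine le_antisymm (SimpleGraph.dist_map_le (inlHom X K x₀ M) (hX u v)) ?_
  have hmin : ∀ e : MulAction.orbit A (((1 : A) : A ⧸ K), x₀),
      sInf (X.dist u '' feet K x₀ e.1.1) ≤ X.dist u e.1.2 ∧
      X.dist u e.1.2 ≤ sInf (X.dist u '' feet K x₀ e.1.1) + M := by
    intro e
    have he : e.1.2 ∈ feet K x₀ e.1.1 := ⟨e, rfl, rfl⟩
    refine ⟨Nat.sInf_le ⟨_, he, rfl⟩, ?_⟩
    obtain ⟨w, hw, hw'⟩ := Nat.sInf_mem (s := X.dist u '' feet K x₀ e.1.1) ⟨_, _, he, rfl⟩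
    rw [← hw']
    have h₁ := dist_le_of_mem_feet hX hadj hM hw he
    have h₂ := hX.dist_triangle (u := u) (v := w) (w := e.1.2)
    omega
  have hstep : ∀ p q, ConeStep X K x₀ M p q →
      distExt X K x₀ M u q ≤ distExt X K x₀ M u p + 1 ∧
      distExt X K x₀ M u p ≤ distExt X K x₀ M u q + 1 := by
    rintro _ _ (h | e | ⟨e, i⟩ | e)
    · rename_i a b
      have h₁ : X.dist a b = 1 := SimpleGraph.dist_eq_one_iff_adj.2 h
      have h₂ := hX.dist_triangle (u := u) (v := a) (w := b)
      have h₃ := hX.dist_triangle (u := u) (v := b) (w := a)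
      rw [X.dist_comm (u := b)] at h₃
      simp only [distExt]
      omega
    · have := hmin e
      simp only [distExt, Fin.val_zero]
      omega
    · have := hmin e
      simp only [distExt, Fin.val_castSucc, Fin.val_succ]
      omega
    · have := hmin e
      simp only [distExt, Fin.val_last]
      omega
  have h := SimpleGraph.le_add_dist_of_adj (connected (K := K) (x₀ := x₀) (M := M) hX)
    (f := distExt X K x₀ M u)
    (fun a b hab => hab.elim (fun h => (hstep a b h).1) (fun h => (hstep b a h).2))
    (Sum.inl u) (Sum.inl v)
  simpa [distExt] using h

theorem isHyperbolicGraph (hX : X.Connected)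
    (hadj : ∀ (a : A) (u v : V), X.Adj u v → X.Adj (a • u) (a • v))
    (hM : ∀ k ∈ K, X.dist x₀ (k • x₀) ≤ M) (hyp : IsHyperbolicGraph X) :
    IsHyperbolicGraph (coneGraph X K x₀ M) := by
  obtain ⟨δ, hδ⟩ := hyp
  refine ⟨δ + 8 * (M + 2), ?_⟩
  have hc := connected (K := K) (x₀ := x₀) (M := M) hX
  have hρ : ∀ p : V ⊕ ConePart K x₀ M, ∃ v : V,
      (coneGraph X K x₀ M).dist (Sum.inl v) p ≤ M + 2 := fun p => by
    obtain ⟨v, w, hw⟩ := exists_walk_inl (X := X) p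
    exact ⟨v, (SimpleGraph.dist_le w).trans hw⟩
  choose ρ hρ using hρ
  have key : ∀ p q, (coneGraph X K x₀ M).dist p q ≤ X.dist (ρ p) (ρ q) + 2 * (M + 2) ∧
      X.dist (ρ p) (ρ q) ≤ (coneGraph X K x₀ M).dist p q + 2 * (M + 2) := by
    intro p q
    rw [← dist_inl (K := K) (x₀ := x₀) hX hadj hM]
    have h₁ := hρ p
    have h₂ := hρ q
    have h₁' := h₁
    have h₂' := h₂
    rw [SimpleGraph.dist_comm] at h₁' h₂'
    have t₁ := hc.dist_triangle (u := p) (v := Sum.inl (ρ p)) (w := q)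
    have t₂ := hc.dist_triangle (u := Sum.inl (ρ p)) (v := Sum.inl (ρ q)) (w := q)
    have t₃ := hc.dist_triangle (u := Sum.inl (ρ p)) (v := p) (w := Sum.inl (ρ q))
    have t₄ := hc.dist_triangle (u := p) (v := q) (w := Sum.inl (ρ q))
    omega
  intro x y z w
  have h := hδ (ρ x) (ρ y) (ρ z) (ρ w)
  have k₁ := key x y
  have k₂ := key x z
  have k₃ := key x w
  have k₄ := key y z
  have k₅ := key y w
  have k₆ := key z w
  omega

end coneGraph

/-! ### Finiteness properties of the cone graph -/

namespace coneGraph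

open ConePart

section Finiteness

variable {A V : Type u} [Group A] [MulAction A V] {X : SimpleGraph V} {K : Subgroup A} {x₀ : V}
  {M : ℕ}

theorem smul_mem_feet {c : A ⧸ K} {w : V} (a : A) (hw : w ∈ feet K x₀ c) :
    a • w ∈ feet K x₀ (a • c) := by
  obtain ⟨e, rfl, rfl⟩ := hw
  exact ⟨a • e, rfl, rfl⟩

/-- The union of the geodesics of `X` between the feet of the cone of `c`. -/
def hull (X : SimpleGraph V) (K : Subgroup A) (x₀ : V) (c : A ⧸ K) : Set V :=
  ⋃ u ∈ feet K x₀ c, ⋃ v ∈ feet K x₀ c, X.interval u v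

theorem smul_mem_hull (hX : X.Connected)
    (hadj : ∀ (a : A) (u v : V), X.Adj u v → X.Adj (a • u) (a • v)) {c : A ⧸ K} {x : V} (a : A)
    (hx : x ∈ hull X K x₀ c) : a • x ∈ hull X K x₀ (a • c) := by
  simp only [hull, Set.mem_iUnion] at hx ⊢
  obtain ⟨u, hu, v, hv, h⟩ := hx
  refine ⟨a • u, smul_mem_feet a hu, a • v, smul_mem_feet a hv, ?_⟩
  change X.dist _ _ + X.dist _ _ = X.dist _ _
  simp only [SimpleGraph.dist_smul hX hadj]
  exact h

variable [TopologicalSpace A] [IsTopologicalGroup A]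

theorem finite_feet (hK : IsCompact (K : Set A))
    (hx₀ : IsOpen (MulAction.stabilizer A x₀ : Set A)) (c : A ⧸ K) : (feet K x₀ c).Finite := by
  obtain ⟨a, rfl⟩ := QuotientGroup.mk_surjective c
  refine ((hK.finite_image_smul hx₀).image (a • ·)).subset ?_
  intro w hw
  obtain ⟨k, hk, rfl⟩ := mem_feet_mk.1 hw
  exact ⟨_, ⟨k, hk, rfl⟩, rfl⟩

theorem finite_setOf_coset_eq (hK : IsCompact (K : Set A))
    (hx₀ : IsOpen (MulAction.stabilizer A x₀ : Set A)) (c : A ⧸ K) :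
    {z : ConePart K x₀ M | z.coset = c}.Finite := by
  have hlegs : {e : MulAction.orbit A (((1 : A) : A ⧸ K), x₀) | e.1.1 = c}.Finite := by
    refine Set.Finite.of_injOn (f := fun e => e.1.2) (t := feet K x₀ c)
      (fun e he => ⟨e, he, rfl⟩) ?_ (finite_feet hK hx₀ c)
    intro e he e' he' h
    exact Subtype.ext (Prod.ext (he.trans he'.symm) h)
  refine ((hlegs.biUnion fun e _ => Set.finite_range (leg (M := M) e)).union
    (Set.finite_singleton (apex c))).subset ?_
  rintro (⟨e, i⟩ | c') h
  · left
    simp only [Set.mem_iUnion]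
    exact ⟨e, h, i, rfl⟩
  · right
    exact congrArg apex h

theorem finite_hull (hX : X.Connected) (hfine : IsFineGraph X) (hK : IsCompact (K : Set A))
    (hx₀ : IsOpen (MulAction.stabilizer A x₀ : Set A)) (c : A ⧸ K) : (hull X K x₀ c).Finite :=
  (finite_feet hK hx₀ c).biUnion fun u _ => (finite_feet hK hx₀ c).biUnion fun v _ =>
    hfine.finite_interval hX u v

/-- The translates of the hull that contain two given distinct vertices correspond to finitely
many cosets of `K`, since the common stabilizer of the two vertices is compact. -/
theorem finite_setOf_mem_hull (hX : X.Connected)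
    (hadj : ∀ (a : A) (u v : V), X.Adj u v → X.Adj (a • u) (a • v)) (hfine : IsFineGraph X)
    (hK : IsCompact (K : Set A)) (hKo : IsOpen (K : Set A))
    (hx₀ : IsOpen (MulAction.stabilizer A x₀ : Set A))
    (hpair : ∀ u v : V, u ≠ v →
      IsCompact (MulAction.stabilizer A u ∩ MulAction.stabilizer A v : Set A))
    {u v : V} (huv : u ≠ v) : {c | u ∈ hull X K x₀ c ∧ v ∈ hull X K x₀ c}.Finite := by
  have hfin := finite_hull hX hfine hK hx₀ ((1 : A) : A ⧸ K)
  have hone : IsOpen (MulAction.stabilizer A ((1 : A) : A ⧸ K) : Set A) := by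
    rwa [MulAction.stabilizer_quotient]
  refine ((hfin.prod hfin).biUnion (t := fun p => {c | p.1 ≠ p.2 ∧
    c ∈ (fun a : A => a • ((1 : A) : A ⧸ K)) '' {a | a • p.1 = u ∧ a • p.2 = v}})
    fun p _ => ?_).subset ?_
  · by_cases hp : p.1 = p.2
    · exact Set.finite_empty.subset fun c hc => hc.1 hp
    · exact ((isCompact_setOf_smul_eq_and_smul_eq (hpair _ _ hp) u v).finite_image_smul
        hone).subset fun c hc => hc.2
  · rintro c ⟨hu, hv⟩
    obtain ⟨a, rfl⟩ := QuotientGroup.mk_surjective c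
    have hc : a⁻¹ • (a : A ⧸ K) = ((1 : A) : A ⧸ K) := by
      change ((a⁻¹ * a : A) : A ⧸ K) = _
      rw [inv_mul_cancel]
    have hu' := smul_mem_hull hX hadj a⁻¹ hu
    have hv' := smul_mem_hull hX hadj a⁻¹ hv
    rw [hc] at hu' hv'
    simp only [Set.mem_iUnion]
    refine ⟨(a⁻¹ • u, a⁻¹ • v), ⟨hu', hv'⟩, fun h => huv (smul_left_cancel _ h), a, ?_, ?_⟩
    · exact ⟨smul_inv_smul _ _, smul_inv_smul _ _⟩
    · change ((a * 1 : A) : A ⧸ K) = _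
      rw [mul_one]

theorem angleFinite (hX : X.Connected)
    (hadj : ∀ (a : A) (u v : V), X.Adj u v → X.Adj (a • u) (a • v)) (hfine : IsFineGraph X)
    (hK : IsCompact (K : Set A)) (hKo : IsOpen (K : Set A))
    (hx₀ : IsOpen (MulAction.stabilizer A x₀ : Set A))
    (hpair : ∀ u v : V, u ≠ v →
      IsCompact (MulAction.stabilizer A u ∩ MulAction.stabilizer A v : Set A))
    (hM : ∀ k ∈ K, X.dist x₀ (k • x₀) ≤ M) : (coneGraph X K x₀ M).AngleFinite := by
  refine hfine.angleFinite.attach coset (feet K x₀) (hull X K x₀) M (fun _ _ => adj_inl.1)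
    (fun _ _ => mem_feet_of_adj) (fun _ _ => coset_eq_of_adj) (finite_setOf_coset_eq hK hx₀)
    (finite_hull hX hfine hK hx₀) (fun c u hu v hv => ?_)
    (fun u v huv => finite_setOf_mem_hull hX hadj hfine hK hKo hx₀ hpair huv)
  obtain ⟨p, hp⟩ := hX.exists_walk_length_eq_dist u v
  refine ⟨p, hp ▸ dist_le_of_mem_feet hX hadj hM hu hv, fun x hx => ?_⟩
  simp only [hull, Set.mem_iUnion]
  exact ⟨u, hu, v, hv, mem_interval_of_mem_support p hp hx⟩

end Finiteness

section CayleyAbels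

variable {A V : Type u} [Group A] [MulAction A V] {X : SimpleGraph V} {K : Subgroup A} {x₀ : V}
  {M : ℕ} {ℋ : Set (Subgroup A)}

theorem stabilizer_inl (v : V) :
    MulAction.stabilizer A (Sum.inl v : V ⊕ ConePart K x₀ M) = MulAction.stabilizer A v := by
  ext a
  simp [MulAction.mem_stabilizer_iff]

theorem stabilizer_inr (z : ConePart K x₀ M) :
    MulAction.stabilizer A (Sum.inr z : V ⊕ ConePart K x₀ M) = MulAction.stabilizer A z := by
  ext a
  simp [MulAction.mem_stabilizer_iff]

theorem stabilizer_apex (c : A ⧸ K) :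
    MulAction.stabilizer A (apex c : ConePart K x₀ M) = MulAction.stabilizer A c := by
  ext a
  simp [MulAction.mem_stabilizer_iff, smul_apex]

theorem stabilizer_leg (e : MulAction.orbit A (((1 : A) : A ⧸ K), x₀)) (i : Fin (M + 1)) :
    MulAction.stabilizer A (leg e i : ConePart K x₀ M) =
      MulAction.stabilizer A e.1.1 ⊓ MulAction.stabilizer A e.1.2 := by
  ext a
  simp [MulAction.mem_stabilizer_iff, smul_leg, Subtype.ext_iff, Prod.ext_iff]

variable [TopologicalSpace A] [IsTopologicalGroup A]

theorem isOpen_stabilizer_coset (hKo : IsOpen (K : Set A)) (c : A ⧸ K) :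
    IsOpen (MulAction.stabilizer A c : Set A) := by
  obtain ⟨a, rfl⟩ := QuotientGroup.mk_surjective c
  rw [stabilizer_quotient_mk]
  exact isOpen_conjSubgroup hKo a

theorem isOpen_stabilizer (hKo : IsOpen (K : Set A))
    (hX : ∀ v : V, IsOpen (MulAction.stabilizer A v : Set A)) (p : V ⊕ ConePart K x₀ M) :
    IsOpen (MulAction.stabilizer A p : Set A) := by
  rcases p with v | ⟨e, i⟩ | c
  · rw [stabilizer_inl]
    exact hX v
  · rw [stabilizer_inr, stabilizer_leg]
    exact (isOpen_stabilizer_coset hKo _).inter (hX _)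
  · rw [stabilizer_inr, stabilizer_apex]
    exact isOpen_stabilizer_coset hKo c

theorem isCompact_stabilizer_inr (hK : IsCompact (K : Set A)) (hKo : IsOpen (K : Set A))
    (hX : ∀ v : V, IsOpen (MulAction.stabilizer A v : Set A)) (z : ConePart K x₀ M) :
    IsCompact (MulAction.stabilizer A (Sum.inr z : V ⊕ ConePart K x₀ M) : Set A) := by
  have h : IsCompact (MulAction.stabilizer A z.coset : Set A) := by
    obtain ⟨a, ha⟩ := QuotientGroup.mk_surjective z.coset
    rw [← ha, stabilizer_quotient_mk]
    exact isCompact_conjSubgroup hK a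
  refine h.of_isClosed_subset (isClosed_stabilizer (isOpen_stabilizer hKo hX _)) ?_
  rw [stabilizer_inr]
  exact z.stabilizer_le

theorem isRelCayleyAbelsGraph (hX : IsRelCayleyAbelsGraph ℋ X) (hfine : IsFineGraph X)
    (hK : IsCompact (K : Set A)) (hKo : IsOpen (K : Set A))
    (hM : ∀ k ∈ K, X.dist x₀ (k • x₀) ≤ M) :
    IsRelCayleyAbelsGraph ℋ (coneGraph X K x₀ M) := by
  have hopen := isOpen_stabilizer (x₀ := x₀) (M := M) hKo hX.isOpen_stabilizer
  have hcpt := isCompact_stabilizer_inr (x₀ := x₀) (M := M) hK hKo hX.isOpen_stabilizer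
  have happ : ∀ c : A ⧸ K, ∃ a : A, c = a • ((1 : A) : A ⧸ K) := fun c => by
    obtain ⟨a, rfl⟩ := QuotientGroup.mk_surjective c
    refine ⟨a, ?_⟩
    change _ = ((a * 1 : A) : A ⧸ K)
    rw [mul_one]
  refine .of_angleFinite ?_ (connected hX.connected) (adj_smul hX.smul_adj) ?_ ?_ hopen ?_ ?_ ?_
  · exact angleFinite hX.connected hX.smul_adj hfine hK hKo (hX.isOpen_stabilizer x₀)
      (fun u v => hX.isCompact_of_ne hfine) hM
  · obtain ⟨F, hF, h⟩ := hX.finite_vertex_orbits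
    refine ⟨Sum.inl '' F ∪ (Set.range (fun i => Sum.inr (leg (baseLeg K x₀) i)) ∪
      {Sum.inr (apex ((1 : A) : A ⧸ K))}), (hF.image _).union
        ((Set.finite_range _).union (Set.finite_singleton _)), ?_⟩
    rintro (v | ⟨e, i⟩ | c)
    · obtain ⟨a, w, hw, rfl⟩ := h v
      exact ⟨a, _, Or.inl ⟨w, hw, rfl⟩, rfl⟩
    · obtain ⟨a, rfl⟩ := exists_smul_baseLeg e
      exact ⟨a, _, Or.inr (Or.inl ⟨i, rfl⟩), rfl⟩
    · obtain ⟨a, rfl⟩ := happ c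
      exact ⟨a, _, Or.inr (Or.inr rfl), rfl⟩
  · obtain ⟨F, hF, h⟩ := hX.exists_finite_edge_orbits
    let E : Set ((V ⊕ ConePart K x₀ M) × (V ⊕ ConePart K x₀ M)) :=
      (fun e : V × V => (Sum.inl e.1, Sum.inl e.2)) '' F ∪
      ({(Sum.inl x₀, Sum.inr (leg (baseLeg K x₀) 0))} ∪
      (Set.range (fun i : Fin M => (Sum.inr (leg (baseLeg K x₀) i.castSucc),
        Sum.inr (leg (baseLeg K x₀) i.succ))) ∪
      {(Sum.inr (leg (baseLeg K x₀) (Fin.last M)), Sum.inr (apex ((1 : A) : A ⧸ K)))}))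
    have hE : E.Finite := (hF.image _).union ((Set.finite_singleton _).union
      ((Set.finite_range _).union (Set.finite_singleton _)))
    have key : ∀ p q, ConeStep X K x₀ M p q → ∃ a : A, ∃ e ∈ E,
        (p = a • e.1 ∧ q = a • e.2) ∨ (p = a • e.2 ∧ q = a • e.1) := by
      rintro _ _ (huv | e | ⟨e, i⟩ | e)
      · obtain ⟨a, e, he, h'⟩ := h _ _ huv
        refine ⟨a, _, Or.inl ⟨e, he, rfl⟩, ?_⟩
        simpa using h'
      · obtain ⟨a, rfl⟩ := exists_smul_baseLeg e
        exact ⟨a, _, Or.inr (Or.inl rfl), Or.inl ⟨rfl, rfl⟩⟩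
      · obtain ⟨a, rfl⟩ := exists_smul_baseLeg e
        exact ⟨a, _, Or.inr (Or.inr (Or.inl ⟨i, rfl⟩)), Or.inl ⟨rfl, rfl⟩⟩
      · obtain ⟨a, rfl⟩ := exists_smul_baseLeg e
        exact ⟨a, _, Or.inr (Or.inr (Or.inr rfl)), Or.inl ⟨rfl, rfl⟩⟩
    refine ⟨E, hE, fun p q hpq => ?_⟩
    rcases hpq with hpq | hpq
    · exact key p q hpq
    · obtain ⟨a, e, he, h'⟩ := key q p hpq
      exact ⟨a, e, he, h'.symm.imp And.symm And.symm⟩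
  · rintro (u | z) (v | z') hpq
    · rw [stabilizer_inl, stabilizer_inl]
      exact hX.isCompact_of_adj u v (adj_inl.1 hpq)
    · exact (hcpt z').inter_left (isClosed_stabilizer (hopen _))
    · exact (hcpt z).inter_right (isClosed_stabilizer (hopen _))
    · exact (hcpt z).inter_right (isClosed_stabilizer (hopen _))
  · rintro (v | z)
    · rw [stabilizer_inl]
      exact hX.vertex_stabilizer v
    · exact Or.inl (hcpt z)
  · intro H hH
    obtain ⟨v, hv⟩ := hX.exists_stabilizer_eq H hH
    exact ⟨Sum.inl v, by rw [stabilizer_inl, hv]⟩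

end CayleyAbels

end coneGraph

/-- A fine hyperbolic Cayley-Abels graph can be enlarged so that a given compact open subgroup
becomes a vertex stabilizer. -/
theorem IsRelCayleyAbelsGraph.exists_stabilizer_eq_of_isCompact {A V : Type u} [Group A]
    [TopologicalSpace A] [IsTopologicalGroup A] [MulAction A V] {X : SimpleGraph V}
    {ℋ : Set (Subgroup A)} (hX : IsRelCayleyAbelsGraph ℋ X) (hfine : IsFineGraph X)
    (hhyp : IsHyperbolicGraph X) {K : Subgroup A} (hK : IsCompact (K : Set A))
    (hKo : IsOpen (K : Set A)) :
    ∃ (V' : Type u) (_ : MulAction A V') (X' : SimpleGraph V'),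
      IsRelCayleyAbelsGraph ℋ X' ∧ IsFineGraph X' ∧ IsHyperbolicGraph X' ∧
      (∃ x : V', MulAction.stabilizer A x = K) ∧
      ∀ v : V, ∃ v' : V', MulAction.stabilizer A v' = MulAction.stabilizer A v := by
  obtain ⟨x₀⟩ := hX.connected.nonempty
  obtain ⟨M, hM⟩ := ((hK.finite_image_smul (hX.isOpen_stabilizer x₀)).image (X.dist x₀)).bddAbove
  have hM' : ∀ k ∈ K, X.dist x₀ (k • x₀) ≤ M := fun k hk => hM ⟨_, ⟨k, hk, rfl⟩, rfl⟩
  refine ⟨_, inferInstance, coneGraph X K x₀ M,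
    coneGraph.isRelCayleyAbelsGraph hX hfine hK hKo hM',
    (coneGraph.angleFinite hX.connected hX.smul_adj hfine hK hKo (hX.isOpen_stabilizer x₀)
      (fun u v => hX.isCompact_of_ne hfine) hM').isFineGraph,
    coneGraph.isHyperbolicGraph hX.connected hX.smul_adj hM' hhyp, ⟨?_, ?_⟩, ?_⟩
  · exact Sum.inr (ConePart.apex ((1 : A) : A ⧸ K))
  · rw [coneGraph.stabilizer_inr, coneGraph.stabilizer_apex, MulAction.stabilizer_quotient]
  · exact fun v => ⟨Sum.inl v, coneGraph.stabilizer_inl v⟩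

/-! ### Induced actions -/

section Induced

variable {A G V : Type u} [Group A] [Group G] [MulAction A V]

/-- The relation `(g * ι a, v) ~ (g, a • v)` on `G × V`. -/
def inducedSetoid (ι : A →* G) (V : Type u) [MulAction A V] : Setoid (G × V) where
  r p q := ∃ a : A, q.1 = p.1 * ι a ∧ p.2 = a • q.2
  iseqv :=
    { refl := fun p => ⟨1, by simp, by simp⟩
      symm := by
        rintro p q ⟨a, h₁, h₂⟩
        exact ⟨a⁻¹, by simp [h₁], by simp [h₂]⟩
      trans := by
        rintro p q r ⟨a, h₁, h₂⟩ ⟨b, h₃, h₄⟩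
        exact ⟨a * b, by simp [h₁, h₃, mul_assoc], by simp [h₂, h₄, mul_smul]⟩ }

/-- The `G`-set `G ×_A V` induced from the `A`-set `V` along `ι : A → G`. -/
def Induced (ι : A →* G) (V : Type u) [MulAction A V] : Type u :=
  Quotient (inducedSetoid ι V)

namespace Induced

variable {ι : A →* G}

/-- The class of `(g, v)` in `G ×_A V`. -/
def mk (ι : A →* G) (g : G) (v : V) : Induced ι V := Quotient.mk (inducedSetoid ι V) (g, v)

theorem exists_mk_eq (p : Induced ι V) : ∃ g v, mk ι g v = p := by
  obtain ⟨⟨g, v⟩, rfl⟩ := Quotient.exists_rep p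
  exact ⟨g, v, rfl⟩

theorem mk_eq_mk {g h : G} {u v : V} :
    mk ι g u = mk ι h v ↔ ∃ a : A, h = g * ι a ∧ u = a • v :=
  Quotient.eq (r := inducedSetoid ι V)

theorem mk_mul (g : G) (a : A) (v : V) : mk ι (g * ι a) v = mk ι g (a • v) :=
  (mk_eq_mk.2 ⟨a, rfl, rfl⟩).symm

theorem mk_injective (hι : Function.Injective ι) (g : G) :
    Function.Injective (mk ι g : V → Induced ι V) := by
  intro u v h
  obtain ⟨a, ha, rfl⟩ := mk_eq_mk.1 h
  have : a = 1 := hι (by simpa using ha)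
  rw [this, one_smul]

instance : MulAction G (Induced ι V) where
  smul g := Quotient.map (fun p => (g * p.1, p.2)) (by
    rintro p q ⟨a, h₁, h₂⟩
    exact ⟨a, by simp [h₁, mul_assoc], h₂⟩)
  one_smul p := by
    obtain ⟨g, v, rfl⟩ := exists_mk_eq p
    exact congrArg (mk ι · v) (one_mul g)
  mul_smul a b p := by
    obtain ⟨g, v, rfl⟩ := exists_mk_eq p
    exact congrArg (mk ι · v) (mul_assoc a b g)

theorem smul_mk (g h : G) (v : V) : g • mk ι h v = mk ι (g * h) v := rfl

theorem stabilizer_mk_one (v : V) :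
    MulAction.stabilizer G (mk ι 1 v) = (MulAction.stabilizer A v).map ι := by
  ext g
  rw [MulAction.mem_stabilizer_iff, smul_mk, mul_one, Subgroup.mem_map]
  constructor
  · intro h
    obtain ⟨a, rfl, ha⟩ := mk_eq_mk.1 h.symm
    exact ⟨a, ha.symm, by simp⟩
  · rintro ⟨a, ha, rfl⟩
    rw [← one_mul (ι a), mk_mul]
    exact congrArg _ ha

theorem stabilizer_mk (g : G) (v : V) :
    MulAction.stabilizer G (mk ι g v) = conjSubgroup g ((MulAction.stabilizer A v).map ι) := by
  rw [← stabilizer_mk_one, ← stabilizer_smul_eq_conjSubgroup, smul_mk, mul_one]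

/-- The disjoint union of the translates of `X` by the cosets of `A` in `G`. The condition `p ≠ q`
is automatic if `ι` is injective. -/
def graph (ι : A →* G) (X : SimpleGraph V) : SimpleGraph (Induced ι V) where
  Adj p q := p ≠ q ∧ ∃ g u v, X.Adj u v ∧ p = mk ι g u ∧ q = mk ι g v
  symm := ⟨by
    rintro p q ⟨h, g, u, v, huv, hp, hq⟩
    exact ⟨h.symm, g, v, u, huv.symm, hq, hp⟩⟩
  loopless := ⟨fun p h => h.1 rfl⟩

variable {X : SimpleGraph V}

theorem adj_mk (hι : Function.Injective ι)
    (hadj : ∀ (a : A) (u v : V), X.Adj u v → X.Adj (a • u) (a • v)) {g : G} {u : V}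
    {q : Induced ι V} : (graph ι X).Adj (mk ι g u) q ↔ ∃ v, X.Adj u v ∧ q = mk ι g v := by
  constructor
  · rintro ⟨-, h, u', v', huv, hp, rfl⟩
    obtain ⟨a, rfl, rfl⟩ := mk_eq_mk.1 hp
    exact ⟨a • v', hadj a _ _ huv, mk_mul _ _ _⟩
  · rintro ⟨v, huv, rfl⟩
    exact ⟨fun h => huv.ne (mk_injective hι g h), g, u, v, huv, rfl, rfl⟩

theorem adj_mk_mk (hι : Function.Injective ι)
    (hadj : ∀ (a : A) (u v : V), X.Adj u v → X.Adj (a • u) (a • v)) {g : G} {u v : V} :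
    (graph ι X).Adj (mk ι g u) (mk ι g v) ↔ X.Adj u v := by
  rw [adj_mk hι hadj]
  constructor
  · rintro ⟨w, h, hw⟩
    rwa [mk_injective hι g hw]
  · exact fun h => ⟨v, h, rfl⟩

theorem angleFinite_graph (hι : Function.Injective ι)
    (hadj : ∀ (a : A) (u v : V), X.Adj u v → X.Adj (a • u) (a • v)) (hX : X.AngleFinite) :
    (graph ι X).AngleFinite := by
  intro p s n
  obtain ⟨g, v, rfl⟩ := exists_mk_eq p
  have lift : ∀ {n a q}, StepsLE ((graph ι X).AdjAvoiding (mk ι g v)) n (mk ι g a) q →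
      ∃ b, q = mk ι g b ∧ StepsLE (X.AdjAvoiding v) n a b := by
    intro n a q h
    generalize hs : mk ι g a = s at h
    induction h with
    | refl n q => exact ⟨a, hs.symm, StepsLE.refl _ _⟩
    | tail _ h ih =>
      obtain ⟨b, rfl, hb⟩ := ih hs
      obtain ⟨h₁, h₂, h₃⟩ := h
      obtain ⟨c, hc, rfl⟩ := (adj_mk hι hadj).1 h₁
      exact ⟨c, rfl, hb.tail ⟨hc, fun h => h₂ (congrArg _ h), fun h => h₃ (congrArg _ h)⟩⟩
  by_cases hs : ∃ a, s = mk ι g a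
  · obtain ⟨a, rfl⟩ := hs
    refine ((hX v a n).image (mk ι g)).subset ?_
    rintro y ⟨hy, h⟩
    obtain ⟨b, rfl, hb⟩ := lift h
    exact ⟨b, ⟨(adj_mk_mk hι hadj).1 hy, hb⟩, rfl⟩
  · refine Set.finite_empty.subset ?_
    rintro y ⟨hy, h⟩
    obtain ⟨b, -, rfl⟩ := (adj_mk hι hadj).1 hy
    obtain ⟨a, ha, -⟩ := lift (h.symm fun _ _ => AdjAvoiding.symm)
    exact hs ⟨a, ha⟩

/-- The inclusion of a translate of `X`. -/
def mkHom (hι : Function.Injective ι)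
    (hadj : ∀ (a : A) (u v : V), X.Adj u v → X.Adj (a • u) (a • v)) (g : G) :
    X →g graph ι X where
  toFun := mk ι g
  map_rel' h := (adj_mk_mk hι hadj).2 h

theorem exists_walk_of_walk (hι : Function.Injective ι)
    (hadj : ∀ (a : A) (u v : V), X.Adj u v → X.Adj (a • u) (a • v)) {g : G} {p q : Induced ι V}
    (w : (graph ι X).Walk p q) {u : V} (hu : p = mk ι g u) :
    ∃ v, q = mk ι g v ∧ ∃ w' : X.Walk u v, w'.length = w.length := by
  induction w generalizing u with
  | nil => exact ⟨u, hu, Walk.nil, rfl⟩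
  | cons h w ih =>
    subst hu
    obtain ⟨x, hx, rfl⟩ := (adj_mk hι hadj).1 h
    obtain ⟨v, rfl, w', hw'⟩ := ih rfl
    exact ⟨v, rfl, Walk.cons hx w', by simp [hw']⟩

theorem dist_mk_mk (hι : Function.Injective ι) (hX : X.Connected)
    (hadj : ∀ (a : A) (u v : V), X.Adj u v → X.Adj (a • u) (a • v)) (g : G) (u v : V) :
    (graph ι X).dist (mk ι g u) (mk ι g v) = X.dist u v := by
  refine le_antisymm (dist_map_le (mkHom hι hadj g) (hX u v)) ?_
  obtain ⟨p, hp⟩ := ((hX u v).map (mkHom hι hadj g)).exists_walk_length_eq_dist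
  obtain ⟨v', hv', w, hw⟩ := exists_walk_of_walk hι hadj p (u := u) rfl
  obtain rfl := mk_injective hι g hv'
  exact (dist_le w).trans_eq (hw.trans hp)

end Induced

end Induced

/-! ### Half-spaces in an HNN extension -/

namespace HNNExtension

section HalfSpace

variable {A : Type u} [Group A] {C D : Subgroup A} {φ : C ≃* D}

open Classical in
/-- The function `1` on `t⁻¹ D` and `0` elsewhere, where `D` is the second associated subgroup. -/
noncomputable def edgeIndicator (x : HNNExtension A C D φ) : ℤ :=
  if t * x ∈ D.map (of : A →* HNNExtension A C D φ) then 1 else 0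

open Classical in
theorem edgeIndicator_of_mul (c : C) (x : HNNExtension A C D φ) :
    edgeIndicator (of (c : A) * x) = edgeIndicator x := by
  have h : t * (of (c : A) * x) = of (φ c : A) * (t * x) := by
    rw [← mul_assoc, t_mul_of, mul_assoc]
  have hmem : of (φ c : A) ∈ D.map (of : A →* HNNExtension A C D φ) :=
    Subgroup.mem_map_of_mem _ (φ c).2
  have hiff : t * (of (c : A) * x) ∈ D.map (of : A →* HNNExtension A C D φ) ↔
      t * x ∈ D.map (of : A →* HNNExtension A C D φ) := by
    rw [h, Subgroup.mul_mem_cancel_left _ hmem]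
  unfold edgeIndicator
  exact if_congr hiff rfl rfl

/-- The action of the HNN extension on its product with `ℤ` that lifts left multiplication, such
that `of a` fixes the second coordinate and `t` raises it on `t⁻¹ D`. -/
noncomputable def heightAction :
    HNNExtension A C D φ →* Equiv.Perm (HNNExtension A C D φ × ℤ) :=
  lift
    { toFun := fun a => (Equiv.mulLeft (of a)).prodCongr (Equiv.refl ℤ)
      map_one' := by ext x <;> simp
      map_mul' := fun a b => by ext x <;> simp [mul_assoc] }
    { toFun := fun x => (t * x.1, x.2 + edgeIndicator x.1)
      invFun := fun x => (t⁻¹ * x.1, x.2 - edgeIndicator (t⁻¹ * x.1))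
      left_inv := fun x => by simp
      right_inv := fun x => by simp }
    (fun c => by
      ext x
      · simp [← mul_assoc, t_mul_of]
      · simp [edgeIndicator_of_mul])

theorem heightAction_of (a : A) (x : HNNExtension A C D φ × ℤ) :
    heightAction (of a : HNNExtension A C D φ) x = (of a * x.1, x.2) := by
  simp [heightAction, Prod.map]

theorem heightAction_t (x : HNNExtension A C D φ × ℤ) :
    heightAction (t : HNNExtension A C D φ) x = (t * x.1, x.2 + edgeIndicator x.1) := by
  simp [heightAction]

theorem heightAction_fst (g : HNNExtension A C D φ) (x : HNNExtension A C D φ × ℤ) :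
    (heightAction g x).1 = g * x.1 := by
  induction g using HNNExtension.induction_on generalizing x with
  | of a => rw [heightAction_of]
  | t => rw [heightAction_t]
  | mul g h hg hh => rw [map_mul, Equiv.Perm.mul_apply, hg, hh, mul_assoc]
  | inv g hg =>
    have := hg (heightAction g⁻¹ x)
    rw [← Equiv.Perm.mul_apply, ← map_mul, mul_inv_cancel, map_one, Equiv.Perm.one_apply] at this
    rw [this, inv_mul_cancel_left]

/-- A function on the HNN extension that is right invariant under `A` and changes between `g` and
`g * t` only if `g ∈ D`. It vanishes at those `g` for which the edge `D` of the Bass-Serre tree,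
from `A` to `t A`, does not separate the vertex `g A` from `A`. -/
noncomputable def height (g : HNNExtension A C D φ) : ℤ :=
  (heightAction g⁻¹ (1, 0)).2

theorem height_one : height (1 : HNNExtension A C D φ) = 0 := by
  simp [height]

theorem height_mul_of (g : HNNExtension A C D φ) (a : A) : height (g * of a) = height g := by
  rw [height, mul_inv_rev, ← map_inv, map_mul, Equiv.Perm.mul_apply, heightAction_of, height]

open Classical in
theorem height_mul_t (g : HNNExtension A C D φ) :
    height (g * t) =
      height g - if g ∈ D.map (of : A →* HNNExtension A C D φ) then 1 else 0 := by
  have h : heightAction g⁻¹ ((1 : HNNExtension A C D φ), 0) =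
      heightAction t (heightAction (g * t)⁻¹ (1, 0)) := by
    rw [← Equiv.Perm.mul_apply, ← map_mul, mul_inv_rev, mul_inv_cancel_left]
  have h₁ : edgeIndicator (heightAction (g * t)⁻¹ ((1 : HNNExtension A C D φ), 0)).1 =
      if g ∈ D.map (of : A →* HNNExtension A C D φ) then 1 else 0 := by
    rw [heightAction_fst, mul_one, mul_inv_rev, edgeIndicator, mul_inv_cancel_left]
    exact if_congr inv_mem_iff rfl rfl
  rw [height, height, h, heightAction_t, ← h₁, add_sub_cancel_right]

theorem height_of (a : A) : height (of a : HNNExtension A C D φ) = 0 := by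
  rw [← one_mul (of a), height_mul_of, height_one]

end HalfSpace

end HNNExtension

/-! ### The graph of an HNN extension -/

/-- The graph of the HNN extension: the translates of `X` by the cosets of `A`, with a bridge from
`g • y` to `g * t • x` for each `g`. If `x` and `y` are fixed by the two associated subgroups,
the bridges correspond to the edges of the Bass-Serre tree. The condition `p ≠ q` is automatic, see
`hnnGraph.mk_ne_mk_mul_t`. -/
def hnnGraph {A V : Type u} [Group A] [MulAction A V] {C D : Subgroup A} (φ : C ≃* D)
    (X : SimpleGraph V) (x y : V) :
    SimpleGraph (Induced (HNNExtension.of : A →* HNNExtension A C D φ) V) where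
  Adj p q := (Induced.graph HNNExtension.of X).Adj p q ∨ p ≠ q ∧
    ((∃ g, p = Induced.mk HNNExtension.of g y ∧
      q = Induced.mk HNNExtension.of (g * HNNExtension.t) x) ∨
    (∃ g, q = Induced.mk HNNExtension.of g y ∧
      p = Induced.mk HNNExtension.of (g * HNNExtension.t) x))
  symm := ⟨fun _ _ h => h.imp SimpleGraph.Adj.symm fun h => ⟨h.1.symm, h.2.symm⟩⟩
  loopless := ⟨fun _ h => h.elim (fun h => h.ne rfl) (fun h => h.1 rfl)⟩

namespace hnnGraph

open HNNExtension

section Algebra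

variable {A V : Type u} [Group A] [MulAction A V] {C D : Subgroup A} {φ : C ≃* D}
  {X : SimpleGraph V} {x y : V}

theorem graph_le : Induced.graph of X ≤ hnnGraph φ X x y := fun _ _ => Or.inl

theorem adj_smul (g : HNNExtension A C D φ)
    (p q : Induced (of : A →* HNNExtension A C D φ) V) (h : (hnnGraph φ X x y).Adj p q) :
    (hnnGraph φ X x y).Adj (g • p) (g • q) := by
  rcases h with ⟨hne, k, u, v, huv, rfl, rfl⟩ | ⟨hne, ⟨k, rfl, rfl⟩ | ⟨k, rfl, rfl⟩⟩
  · exact Or.inl ⟨fun h => hne (smul_left_cancel g h), g * k, u, v, huv, rfl, rfl⟩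
  · refine Or.inr ⟨fun h => hne (smul_left_cancel g h), Or.inl ⟨g * k, rfl, ?_⟩⟩
    rw [Induced.smul_mk, mul_assoc]
  · refine Or.inr ⟨fun h => hne (smul_left_cancel g h), Or.inr ⟨g * k, rfl, ?_⟩⟩
    rw [Induced.smul_mk, mul_assoc]

/-- The vertices on the side of `g A` of the edge `g D` of the Bass-Serre tree. -/
def side (g : HNNExtension A C D φ) (V : Type u) [MulAction A V] :
    Set (Induced (of : A →* HNNExtension A C D φ) V) :=
  {p | ∃ h v, p = Induced.mk of h v ∧ height (g⁻¹ * h) = 0}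

theorem mk_mem_side {g h : HNNExtension A C D φ} {v : V} :
    Induced.mk of h v ∈ side g V ↔ height (g⁻¹ * h) = 0 := by
  constructor
  · rintro ⟨h', v', hv, hh⟩
    obtain ⟨a, rfl, -⟩ := Induced.mk_eq_mk.1 hv
    rwa [← mul_assoc, height_mul_of] at hh
  · exact fun hh => ⟨h, v, rfl, hh⟩

theorem height_t : height (t : HNNExtension A C D φ) = -1 := by
  rw [← one_mul t, height_mul_t, height_one, if_pos (one_mem _)]
  rfl

theorem mk_ne_mk_mul_t (g : HNNExtension A C D φ) (u v : V) :
    Induced.mk of g u ≠ Induced.mk of (g * t) v := by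
  intro h
  obtain ⟨a, ha, -⟩ := Induced.mk_eq_mk.1 h
  have h₁ := height_of (φ := φ) a
  rw [← mul_left_cancel ha, height_t] at h₁
  omega

theorem adj_bridge (g : HNNExtension A C D φ) :
    (hnnGraph φ X x y).Adj (Induced.mk of g y) (Induced.mk of (g * t) x) :=
  Or.inr ⟨mk_ne_mk_mul_t g y x, Or.inl ⟨g, rfl, rfl⟩⟩

theorem isBridgeSide (hx : ∀ c ∈ C, c • x = x) (hy : ∀ d ∈ D, d • y = y)
    (g : HNNExtension A C D φ) :
    IsBridgeSide (hnnGraph φ X x y) (side g V) (Induced.mk of g y)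
      (Induced.mk of (g * t) x) where
  fst_mem := by
    rw [mk_mem_side, inv_mul_cancel, height_one]
  snd_notMem := by
    rw [mk_mem_side, inv_mul_cancel_left, height_t]
    omega
  adj := adj_bridge g
  eq_of_adj p q hpq hp hq := by
    rcases hpq with ⟨-, h, u, v, huv, rfl, rfl⟩ | ⟨-, ⟨h, rfl, rfl⟩ | ⟨h, rfl, rfl⟩⟩
    · rw [mk_mem_side] at hp hq
      exact absurd hp hq
    · rw [mk_mem_side] at hp hq
      rw [← mul_assoc, height_mul_t, hp] at hq
      split_ifs at hq with hD
      · obtain ⟨d, hd, hgh⟩ := hD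
        obtain rfl : h = g * of d := by rw [hgh, mul_inv_cancel_left]
        refine ⟨?_, ?_⟩
        · rw [Induced.mk_mul, hy d hd]
        · have := of_mul_t (φ := φ) ⟨d, hd⟩
          rw [mul_assoc, this, ← mul_assoc, Induced.mk_mul, hx _ (φ.symm ⟨d, hd⟩).2]
      · exact absurd rfl hq
    · rw [mk_mem_side] at hp hq
      rw [← mul_assoc, height_mul_t] at hp
      split_ifs at hp with hD
      · obtain ⟨d, hd, hgh⟩ := hD
        rw [← hgh, height_of] at hq
        exact absurd rfl hq
      · exact absurd (by simpa using hp) hq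

theorem exists_isBridgeSide (hx : ∀ c ∈ C, c • x = x) (hy : ∀ d ∈ D, d • y = y)
    (p q : Induced (of : A →* HNNExtension A C D φ) V) (hpq : (hnnGraph φ X x y).Adj p q)
    (hpq' : ¬ (Induced.graph of X).Adj p q) : ∃ S, IsBridgeSide (hnnGraph φ X x y) S p q := by
  rcases hpq with hpq | ⟨-, ⟨g, rfl, rfl⟩ | ⟨g, rfl, rfl⟩⟩
  · exact absurd hpq hpq'
  · exact ⟨_, isBridgeSide hx hy g⟩
  · exact ⟨_, (isBridgeSide hx hy g).compl⟩

theorem connected (hX : X.Connected)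
    (hadj : ∀ (a : A) (u v : V), X.Adj u v → X.Adj (a • u) (a • v)) :
    (hnnGraph φ X x y).Connected := by
  have hin : ∀ (h : HNNExtension A C D φ) (u v : V),
      (hnnGraph φ X x y).Reachable (Induced.mk of h u) (Induced.mk of h v) := fun h u v =>
    (((hX u v).map (Induced.mkHom (of_injective φ) hadj h))).mono graph_le
  have key : ∀ g h : HNNExtension A C D φ, ∀ u v : V,
      (hnnGraph φ X x y).Reachable (Induced.mk of h u) (Induced.mk of (h * g) v) := by
    intro g
    induction g using HNNExtension.induction_on with
    | of a =>
      intro h u v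
      rw [Induced.mk_mul]
      exact hin h _ _
    | t =>
      intro h u v
      exact (hin h u y).trans ((adj_bridge h).reachable.trans (hin _ x v))
    | mul g₁ g₂ h₁ h₂ =>
      intro h u v
      rw [← mul_assoc]
      exact (h₁ h u v).trans (h₂ _ v v)
    | inv g hg =>
      intro h u v
      simpa using (hg (h * g⁻¹) v u).symm
  have : Nonempty (Induced (of : A →* HNNExtension A C D φ) V) := ⟨Induced.mk of 1 x⟩
  refine ⟨fun p q => ?_⟩
  obtain ⟨g, u, rfl⟩ := Induced.exists_mk_eq p
  obtain ⟨h, v, rfl⟩ := Induced.exists_mk_eq q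
  simpa using key (g⁻¹ * h) g u v

theorem isFineGraph (hadj : ∀ (a : A) (u v : V), X.Adj u v → X.Adj (a • u) (a • v))
    (hx : ∀ c ∈ C, c • x = x) (hy : ∀ d ∈ D, d • y = y) (hfine : IsFineGraph X) :
    IsFineGraph (hnnGraph φ X x y) :=
  .of_bridges graph_le (exists_isBridgeSide hx hy)
    (Induced.angleFinite_graph (of_injective φ) hadj hfine.angleFinite).isFineGraph

theorem isHyperbolicGraph (hX : X.Connected)
    (hadj : ∀ (a : A) (u v : V), X.Adj u v → X.Adj (a • u) (a • v))
    (hx : ∀ c ∈ C, c • x = x) (hy : ∀ d ∈ D, d • y = y) (hhyp : IsHyperbolicGraph X) :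
    IsHyperbolicGraph (hnnGraph φ X x y) := by
  obtain ⟨δ, hδ⟩ := hhyp
  refine .of_bridges graph_le (connected hX hadj) (exists_isBridgeSide hx hy) δ ?_
  intro p q r s hpq hpr hps
  obtain ⟨g, a, rfl⟩ := Induced.exists_mk_eq p
  obtain ⟨w₁⟩ := hpq
  obtain ⟨w₂⟩ := hpr
  obtain ⟨w₃⟩ := hps
  obtain ⟨b, rfl, -⟩ := Induced.exists_walk_of_walk (of_injective φ) hadj w₁ rfl
  obtain ⟨c, rfl, -⟩ := Induced.exists_walk_of_walk (of_injective φ) hadj w₂ rfl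
  obtain ⟨d, rfl, -⟩ := Induced.exists_walk_of_walk (of_injective φ) hadj w₃ rfl
  simp only [Induced.dist_mk_mk (of_injective φ) hX hadj]
  exact hδ a b c d

end Algebra

section Topology

variable {A V : Type u} [Group A] [TopologicalSpace A] [IsTopologicalGroup A] [MulAction A V]
  {C D : Subgroup A} {φ : C ≃* D} {X : SimpleGraph V} {x y : V} {ℋ : Set (Subgroup A)}

theorem isRelCayleyAbelsGraph [IsTopologicalGroup (HNNExtension A C D φ)]
    (hX : IsRelCayleyAbelsGraph ℋ X) (hfine : IsFineGraph X)
    (hx : ∀ c ∈ C, c • x = x) (hy : ∀ d ∈ D, d • y = y)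
    (hyc : IsCompact (MulAction.stabilizer A y : Set A)) :
    IsRelCayleyAbelsGraph
      ((fun H : Subgroup A => H.map (of : A →* HNNExtension A C D φ)) '' ℋ)
      (hnnGraph φ X x y) := by
  have hemb : IsOpenEmbedding (of : A → HNNExtension A C D φ) := isOpenEmbedding_of
  have hopen : ∀ p : Induced (of : A →* HNNExtension A C D φ) V,
      IsOpen (MulAction.stabilizer (HNNExtension A C D φ) p : Set (HNNExtension A C D φ)) := by
    intro p
    obtain ⟨g, v, rfl⟩ := Induced.exists_mk_eq p
    rw [Induced.stabilizer_mk]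
    exact isOpen_conjSubgroup (hemb.isOpenMap _ (hX.isOpen_stabilizer v)) g
  have hcpt : ∀ (g : HNNExtension A C D φ) (v : V), IsCompact (MulAction.stabilizer A v : Set A) →
      IsCompact (MulAction.stabilizer (HNNExtension A C D φ) (Induced.mk of g v) :
        Set (HNNExtension A C D φ)) := by
    intro g v hv
    rw [Induced.stabilizer_mk]
    exact isCompact_conjSubgroup (hv.image hemb.continuous) g
  refine .of_angleFinite (isFineGraph hX.smul_adj hx hy hfine).angleFinite
    (connected hX.connected hX.smul_adj) adj_smul ?_ ?_ hopen ?_ ?_ ?_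
  · obtain ⟨F, hF, h⟩ := hX.finite_vertex_orbits
    refine ⟨Induced.mk of 1 '' F, hF.image _, fun p => ?_⟩
    obtain ⟨g, v, rfl⟩ := Induced.exists_mk_eq p
    obtain ⟨a, w, hw, rfl⟩ := h v
    exact ⟨g * of a, _, ⟨w, hw, rfl⟩, by rw [Induced.smul_mk, mul_one, Induced.mk_mul]⟩
  · obtain ⟨F, hF, h⟩ := hX.exists_finite_edge_orbits
    refine ⟨(fun e : V × V => (Induced.mk of 1 e.1, Induced.mk of 1 e.2)) '' F ∪
      {(Induced.mk of 1 y, Induced.mk of t x)}, (hF.image _).union (Set.finite_singleton _), ?_⟩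
    rintro p q (⟨-, g, u, v, huv, rfl, rfl⟩ | ⟨-, ⟨g, rfl, rfl⟩ | ⟨g, rfl, rfl⟩⟩)
    · obtain ⟨a, e, he, h'⟩ := h u v huv
      refine ⟨g * of a, _, Or.inl ⟨e, he, rfl⟩, ?_⟩
      simp only [Induced.smul_mk, mul_one, Induced.mk_mul]
      exact h'.imp (fun h => ⟨congrArg _ h.1, congrArg _ h.2⟩)
        (fun h => ⟨congrArg _ h.1, congrArg _ h.2⟩)
    · refine ⟨g, _, Or.inr rfl, Or.inl ⟨?_, rfl⟩⟩
      rw [Induced.smul_mk, mul_one]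
    · refine ⟨g, _, Or.inr rfl, Or.inr ⟨rfl, ?_⟩⟩
      rw [Induced.smul_mk, mul_one]
  · rintro p q (⟨-, g, u, v, huv, rfl, rfl⟩ | ⟨-, ⟨g, rfl, rfl⟩ | ⟨g, rfl, rfl⟩⟩)
    · rw [Induced.stabilizer_mk, Induced.stabilizer_mk, ← Subgroup.coe_inf]
      have hinf : ∀ H K : Subgroup A, conjSubgroup g (H.map (of : A →* HNNExtension A C D φ)) ⊓
          conjSubgroup g (K.map of) = conjSubgroup g ((H ⊓ K).map of) := by
        intro H K
        rw [Subgroup.map_inf _ _ _ (of_injective φ)]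
        exact (Subgroup.map_inf _ _ _ (MulAut.conj g).injective).symm
      rw [hinf]
      exact isCompact_conjSubgroup ((hX.isCompact_of_adj u v huv).image hemb.continuous) g
    · exact (hcpt g y hyc).inter_right (isClosed_stabilizer (hopen _))
    · exact (hcpt g y hyc).inter_left (isClosed_stabilizer (hopen _))
  · intro p
    obtain ⟨g, v, rfl⟩ := Induced.exists_mk_eq p
    rcases hX.vertex_stabilizer v with hv | ⟨H, hH, a, ha⟩
    · exact Or.inl (hcpt g v hv)
    · refine Or.inr ⟨_, ⟨H, hH, rfl⟩, g * of a, ?_⟩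
      rw [Induced.stabilizer_mk, ha]
      ext z
      simp only [conjSubgroup, Subgroup.mem_map]
      constructor
      · rintro ⟨_, ⟨_, ⟨b, hb, rfl⟩, rfl⟩, rfl⟩
        exact ⟨_, ⟨b, hb, rfl⟩, by simp [mul_assoc]⟩
      · rintro ⟨_, ⟨b, hb, rfl⟩, rfl⟩
        exact ⟨_, ⟨_, ⟨b, hb, rfl⟩, rfl⟩, by simp [mul_assoc]⟩
  · rintro _ ⟨H, hH, rfl⟩
    obtain ⟨v, hv⟩ := hX.exists_stabilizer_eq H hH
    exact ⟨Induced.mk of 1 v, by rw [Induced.stabilizer_mk_one, hv]⟩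

end Topology

end hnnGraph

/-! ### Topological properties of the HNN extension -/

/-- A topological group with an open subgroup that is TDLC is itself TDLC. -/
theorem IsTDLCGroup.of_isOpenEmbedding {A G : Type u} [Group A] [TopologicalSpace A] [Group G]
    [TopologicalSpace G] [IsTopologicalGroup G] (hA : IsTDLCGroup A) (ι : A →* G)
    (hι : IsOpenEmbedding ι) : IsTDLCGroup G where
  isTopologicalGroup := inferInstance
  t2Space := by
    have := hA.t2Space
    refine IsTopologicalGroup.t2Space_of_one_sep fun x hx => ?_
    by_cases h : ∃ a, ι a = x
    · obtain ⟨a, rfl⟩ := h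
      have ha : (1 : A) ≠ a := fun h => hx (by rw [← h, map_one])
      refine ⟨ι '' {a}ᶜ, ?_, ?_⟩
      · rw [← map_one ι]
        exact hι.isOpenMap.image_mem_nhds (isOpen_compl_singleton.mem_nhds ha)
      · rintro ⟨b, hb, hba⟩
        exact hb (hι.injective hba)
    · refine ⟨Set.range ι, ?_, fun ⟨a, ha⟩ => h ⟨a, ha⟩⟩
      exact hι.isOpen_range.mem_nhds ⟨1, map_one ι⟩
  locallyCompactSpace := by
    have := hA.locallyCompactSpace
    obtain ⟨K, hK, hK1⟩ := exists_compact_mem_nhds (1 : A)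
    refine (hK.image hι.continuous).locallyCompactSpace_of_mem_nhds_of_group (x := 1) ?_
    rw [← map_one ι]
    exact hι.isOpenMap.image_mem_nhds hK1
  totallyDisconnectedSpace := by
    have := hA.totallyDisconnectedSpace
    refine ⟨fun s _ hs x hx y hy => ?_⟩
    -- After a translation `x = 1`, and then `s` lies in the clopen subgroup `A`.
    have hs' : IsPreconnected ((x⁻¹ * ·) '' s) :=
      hs.image _ (continuous_const_mul _).continuousOn
    have hopen : IsOpen (ι.range : Set G) := by
      rw [MonoidHom.coe_range]
      exact hι.isOpen_range
    have hsub : (x⁻¹ * ·) '' s ⊆ Set.range ι := by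
      rw [← MonoidHom.coe_range]
      exact hs'.subset_isClopen ⟨Subgroup.isClosed_of_isOpen _ hopen, hopen⟩
        ⟨1, ⟨x, hx, inv_mul_cancel x⟩, one_mem _⟩
    have hpre : IsPreconnected (ι ⁻¹' ((x⁻¹ * ·) '' s)) := by
      rw [← hι.isInducing.isPreconnected_image, Set.image_preimage_eq_of_subset hsub]
      exact hs'
    obtain ⟨a, ha⟩ := hsub ⟨y, hy, rfl⟩
    have h1 : (1 : A) ∈ ι ⁻¹' ((x⁻¹ * ·) '' s) := ⟨x, hx, by simp⟩
    have h2 : a ∈ ι ⁻¹' ((x⁻¹ * ·) '' s) := ⟨y, hy, ha.symm⟩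
    have h3 : (1 : A) = a := hpre.subsingleton h1 h2
    rw [← h3, map_one] at ha
    exact (inv_mul_eq_one.1 ha.symm)

/-! ### Relative hyperbolicity of the HNN extension -/

theorem theorem1p2 {A : Type u} [Group A] [TopologicalSpace A] (hA : IsTDLCGroup A)
    (ℋ : Set (Subgroup A)) (hfin : ℋ.Finite) (hopen : ∀ H ∈ ℋ, IsOpen (H : Set A))
    (hgen : IsCompactlyGeneratedRel A ℋ) (hhyp : IsHyperbolicRelTo A ℋ)
    (C D : Subgroup A) (hC : IsOpen (C : Set A)) (hD : IsOpen (D : Set A)) (φ : C ≃ₜ* D)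
    (hcomp : IsCompact (C : Set A)) :
    IsHyperbolicRelTo (HNNExtension A C D (φ : C ≃* D))
      ((fun H : Subgroup A => H.map HNNExtension.of) '' ℋ) := by
  have := hA.isTopologicalGroup
  have hG : IsTopologicalGroup (HNNExtension A C D (φ : C ≃* D)) :=
    HNNExtension.isTopologicalGroup φ hC hD
  have hemb : IsOpenEmbedding (HNNExtension.of : A → HNNExtension A C D (φ : C ≃* D)) :=
    HNNExtension.isOpenEmbedding_of
  have hDcomp : IsCompact (D : Set A) := by
    have : CompactSpace C := isCompact_iff_compactSpace.1 hcomp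
    exact isCompact_iff_compactSpace.2 φ.toHomeomorph.compactSpace
  obtain ⟨hproper, V₀, _, X₀, hX₀, hfine₀, hhyp₀⟩ := hhyp
  obtain ⟨V₁, _, X₁, hX₁, hfine₁, hhyp₁, ⟨x₁, hx₁⟩, -⟩ :=
    hX₀.exists_stabilizer_eq_of_isCompact hfine₀ hhyp₀ hcomp hC
  obtain ⟨V, _, X, hX, hfine, hhyp, ⟨y, hy⟩, hV⟩ :=
    hX₁.exists_stabilizer_eq_of_isCompact hfine₁ hhyp₁ hDcomp hD
  obtain ⟨x, hx⟩ := hV x₁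
  have hxC : ∀ c ∈ C, c • x = x := fun c hc => by
    rwa [← MulAction.mem_stabilizer_iff, hx, hx₁]
  have hyD : ∀ d ∈ D, d • y = y := fun d hd => by
    rwa [← MulAction.mem_stabilizer_iff, hy]
  have hY := hnnGraph.isRelCayleyAbelsGraph (φ := (φ : C ≃* D)) hX hfine hxC hyD
    (by rwa [hy])
  have hYfine := hnnGraph.isFineGraph (φ := (φ : C ≃* D)) hX.smul_adj hxC hyD hfine
  refine ⟨⟨hA.of_isOpenEmbedding _ hemb, hfin.image _, ?_, ?_⟩, _, _, _, hY, hYfine,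
    hnnGraph.isHyperbolicGraph hX.connected hX.smul_adj hxC hyD hhyp⟩
  · rintro _ ⟨H, hH, rfl⟩
    exact hemb.isOpenMap _ (hopen H hH)
  · -- Conjugate non-compact members are stabilizers of one and the same vertex of the graph, which
    -- makes them conjugate in `A`.
    rintro _ ⟨H, hH, rfl⟩ _ ⟨K, hK, rfl⟩ hne hHc hKc g hg
    obtain ⟨v, hv⟩ := hX.exists_stabilizer_eq H hH
    obtain ⟨w, hw⟩ := hX.exists_stabilizer_eq K hK
    have hvw : Induced.mk HNNExtension.of g v = Induced.mk HNNExtension.of 1 w := by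
      refine hY.eq_of_stabilizer_eq hYfine ?_ ?_
      · rw [Induced.stabilizer_mk, Induced.stabilizer_mk_one, hv, hw, hg]
      · rw [Induced.stabilizer_mk, hv, hg]
        exact hKc
    obtain ⟨a, -, ha⟩ := Induced.mk_eq_mk.1 hvw
    have hHK : H = conjSubgroup a K := by
      rw [← hv, ← hw, ha, stabilizer_smul_eq_conjSubgroup]
    refine hproper.not_conj K hK H hH ?_ ?_ ?_ a hHK.symm
    · rintro rfl
      exact hne rfl
    · exact fun h => hKc (h.image hemb.continuous)
    · exact fun h => hHc (h.image hemb.continuous)
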